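/- Let $f\in C^\infty(\mathbb R)$ be real valued and suppose that for every $R>0$ there is $M>0$ such that $$|f^{(n)}(x)|\le M^{n+1}\,n!\qquad\text{for all }|x|<R\text{ and all }n\in\{0,1,2,\dots\}.$$ Let $c>0$, and let $\mathscr H$ denote the Hilbert transform in the variable $x$ on $L^2(\mathbb R^2)$, i.e. convolution in $x$ with $\frac1\pi\,\mathrm{p.v.}\frac1x$, the Fourier multiplier with symbol $-i\,\mathrm{sgn}\,\xi$. Let $$\mathscr Z=\{u\in L^2(\mathbb R^2;\mathbb R):\ D_x^{1/2}u\in L^2(\mathbb R^2),\ D_x^{-1/2}u_y\in L^2(\mathbb R^2)\},$$ where $D_x^{s}$ is the Fourier multiplier with symbol $|\xi|^{s}$, and let $H^\infty(\mathbb R^2)=\bigcap_{s}H^s(\mathbb R^2)$. Let $\varphi\in\mathscr Z\cap H^\infty(\mathbb R^2)$ be (the profile of) a solitary wave $u(x,y,t)=\varphi(x-ct,y)$ of $u_t-\mathscr H\Delta u+(f(u))_x=0$, i.e. let $\varphi$ satisfy, in the sense of distributions on $\mathbb R^2$, $$-c\,\varphi_x-\mathscr H\Delta\varphi+(f(\varphi))_x=0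 .$$ Then $\varphi$ is real analytic on $\mathbb R^2$, that is, $\varphi$ agrees almost everywhere with a real analytic function $\mathbb R^2\to\mathbb R$. -/

import Mathlib

open MeasureTheory FourierTransform
open scoped ContDiff Laplacian SchwartzMap ENNReal

/-- The Euclidean plane `ℝ²`; `p 0` is the `x`-coordinate and `p 1` the `y`-coordinate.
On the Fourier side `ζ 0` is dual to `x` and `ζ 1` is dual to `y`. -/
abbrev Plane : Type := EuclideanSpace ℝ (Fin 2)

/-- Complex-valued `L²(ℝ²)`, on which the Fourier transform
`û(ζ) = ∫ u(p) exp(-2πi p·ζ) dp` acts unitarily. -/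
abbrev L2C : Type := Lp ℂ 2 (volume : Measure Plane)

/-- Real-valued `L²(ℝ²)`. -/
abbrev L2R : Type := Lp ℝ 2 (volume : Measure Plane)

/-- A real `L²` function regarded as a complex one. -/
noncomputable def toL2C (u : L2R) : L2C := Complex.ofRealCLM.compLp u

/-- `v = m(D) u` in `L²`: the Fourier transform of `v` is `m` times that of `u`. In particular
`∃ v, IsFourierMultiplierOf m u v` says that `m(D) u`, given by the symbol `m`, lies in `L²`. -/
def IsFourierMultiplierOf (m : Plane → ℂ) (u v : L2C) : Prop :=
  ∀ᵐ ζ, (𝓕 v : L2C) ζ = m ζ * (𝓕 u : L2C) ζ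

/-- The symbol `|2πξ|^s` of the fractional derivative `D_x^s`, with respect to the frequency
variable of the Fourier transform `û(ζ) = ∫ u(p) exp(-2πi p·ζ) dp`. -/
noncomputable def symbolDx (s : ℝ) (ζ : Plane) : ℂ := ((|2 * Real.pi * ζ 0| ^ s : ℝ) : ℂ)

/-- The symbol `2πiη` of `∂_y`. -/
noncomputable def symbolPartialY (ζ : Plane) : ℂ := 2 * Real.pi * Complex.I * (ζ 1 : ℝ)

/-- The space `𝒵` of real `u ∈ L²(ℝ²)` with `D_x^{1/2} u ∈ L²` and `D_x^{-1/2} u_y ∈ L²`. -/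
def MemZ (u : L2R) : Prop :=
  (∃ v : L2C, IsFourierMultiplierOf (symbolDx (1 / 2)) (toL2C u) v) ∧
  (∃ w : L2C,
    IsFourierMultiplierOf (fun ζ => symbolDx (-(1 / 2)) ζ * symbolPartialY ζ) (toL2C u) w)

/-- The Sobolev space `H^∞(ℝ²) = ⋂_s H^s(ℝ²)` of real functions. -/
def MemHInfty (u : L2R) : Prop :=
  ∀ s : ℝ, TemperedDistribution.MemSobolev s 2 (toL2C u : 𝓢'(Plane, ℂ))

/-- The symbol `-i sgn ξ` of the Hilbert transform in `x`. -/
noncomputable def symbolHilbert (ζ : Plane) : ℂ := -Complex.I * ((Real.sign (ζ 0) : ℝ) : ℂ)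

theorem norm_symbolHilbert_le (ζ : Plane) : ‖symbolHilbert ζ‖ ≤ 1 := by
  rcases Real.sign_apply_eq (ζ 0) with h | h | h <;> simp [symbolHilbert, h]

theorem measurable_symbolHilbert : Measurable symbolHilbert := by
  have h : Measurable Real.sign := by
    unfold Real.sign
    exact Measurable.ite measurableSet_Iio measurable_const
      (Measurable.ite measurableSet_Ioi measurable_const measurable_const)
  unfold symbolHilbert
  exact measurable_const.mul (Complex.measurable_ofReal.comp (h.comp (by fun_prop)))

theorem memLp_symbolHilbert_mul (g : L2C) :
    MemLp (fun ζ => symbolHilbert ζ * g ζ) 2 (volume : Measure Plane) := by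
  refine (Lp.memLp g).mono
    (measurable_symbolHilbert.aestronglyMeasurable.mul (Lp.aestronglyMeasurable g)) ?_
  filter_upwards with ζ
  rw [norm_mul]
  exact mul_le_of_le_one_left (norm_nonneg _) (norm_symbolHilbert_le ζ)

/-- The Hilbert transform `ℋ` in the variable `x` on `L²(ℝ²)`, that is, the convolution in `x`
with `(1/π) p.v. 1/x`, defined through its Fourier symbol `-i sgn ξ`. -/
noncomputable def hilbertX (u : L2C) : L2C :=
  𝓕⁻ ((memLp_symbolHilbert_mul (𝓕 u)).toLp _)

/-- The partial derivative `∂_x ψ` of a function on the plane. -/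
noncomputable def partialX (ψ : Plane → ℝ) (p : Plane) : ℝ :=
  fderiv ℝ ψ p (EuclideanSpace.single 0 1)

/-- `φ ∈ L²(ℝ²)` is the profile of a solitary wave `u(x,y,t) = φ(x - ct, y)` of
`u_t - ℋ Δ u + (f(u))_x = 0`: the equation
`-c φ_x - ℋ Δ φ + (f(φ))_x = 0` holds in the sense of distributions on the plane
(where `ℋ Δ φ = Δ ℋ φ`), i.e. after integration against every real test function. -/
def IsSolitaryWave (f : ℝ → ℝ) (c : ℝ) (φ : L2R) : Prop :=
  LocallyIntegrable (fun p => f (φ p)) (volume : Measure Plane) ∧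
  ∀ ψ : Plane → ℝ, ContDiff ℝ ∞ ψ → HasCompactSupport ψ →
    ((c * ∫ p, φ p * partialX ψ p : ℝ) : ℂ)
      - (∫ p, hilbertX (toL2C φ) p * ((Δ ψ p : ℝ) : ℂ))
      - ((∫ p, f (φ p) * partialX ψ p : ℝ) : ℂ) = 0

/-! On the Fourier side the equation reads `sgn ξ (c|ξ| + 2π|ζ|²) Φ = ξ U₀`, where `ζ = (ξ, η)`, `Φ`
is the transform of `φ` and `U₀` that of `f(φ) - f(0)`. Since `c > 0` the two terms on the left have
the same sign, so with `w = |ξ| + |η|` one gets `w|Φ| ≤ |U₀|`: the equation gains one derivative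
(`planeWeight_mul_enorm_le_of_fourierResidual`).

Let `U_k` be the transform of `f⁽ᵏ⁾(φ) - f⁽ᵏ⁾(0)`. The chain rule bounds `w|U_k|` by `|f⁽ᵏ⁺¹⁾(0)|
w|Φ|` plus the convolution of `|U_{k+1}|` with `w|Φ|` (`planeWeight_mul_le`). As `w` is subadditive,
the moments `b_k(n) = ∫ wⁿ|U_k|`, with `|f⁽ᵏ⁾(0)|` added at `n = 0`, satisfy `b_k(n+1) ≤ ∑
binom(n,p) b_{k+1}(p) b_0(n-p)`, a closed system because the equation bounds the moments of `w|Φ|`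
by `b_0`.

The initial values obey `b_k(0) ≤ C Nᵏ k!` (`exists_transforms`), by the analytic bounds on `f` and
the `L²` control of `u - Δu`. The majorant system is solved explicitly (`le_of_binomial_recursion`),
so the moments of `Φ` grow at most like `Aⁿ n!`, and then the inverse Fourier integral is analytic
(`analyticAt_fourierInv`). -/

/-! ### Combinatorics of the majorant recursion, and moments of convolutions. -/

/-- The product `s (s + 2) ⋯ (s + 2 (n - 1))`. -/
def stepTwoFactorial (n s : ℕ) : ℕ := ∏ i ∈ Finset.range n, (s + 2 * i)

theorem stepTwoFactorial_succ_left (n s : ℕ) :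
    stepTwoFactorial (n + 1) s = s * stepTwoFactorial n (s + 2) := by
  rw [stepTwoFactorial, Finset.prod_range_succ', mul_comm]
  simp only [mul_zero, add_zero, stepTwoFactorial]
  congr 1
  exact Finset.prod_congr rfl fun i _ => by ring

theorem stepTwoFactorial_succ_right (n s : ℕ) :
    stepTwoFactorial (n + 1) s = stepTwoFactorial n s * (s + 2 * n) :=
  Finset.prod_range_succ _ _

/-- The Vandermonde convolution for `stepTwoFactorial`. -/
theorem sum_choose_mul_stepTwoFactorial (n s t : ℕ) :
    ∑ p ∈ Finset.HasAntidiagonal.antidiagonal n,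
      n.choose p.1 * (stepTwoFactorial p.1 s * stepTwoFactorial p.2 t) =
      stepTwoFactorial n (s + t) := by
  induction n with
  | zero => simp [stepTwoFactorial]
  | succ n ih =>
    have h := Finset.sum_antidiagonal_choose_succ_mul
      (fun i j => stepTwoFactorial i s * stepTwoFactorial j t) n
    simp only [Nat.cast_id] at h
    rw [h, stepTwoFactorial_succ_right, ← ih, Finset.sum_mul, ← Finset.sum_add_distrib]
    refine Finset.sum_congr rfl fun p hp => ?_
    rw [Finset.HasAntidiagonal.mem_antidiagonal] at hp
    rw [stepTwoFactorial_succ_right, stepTwoFactorial_succ_right, ← hp, ← Nat.choose_symm_add]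
    ring

/-- Each factor `1 + 2i` is at most `2(i + 1)`. This turns the coefficients of the majorant into
factorial growth. -/
theorem stepTwoFactorial_one_le (n : ℕ) : stepTwoFactorial n 1 ≤ 2 ^ n * n.factorial := by
  induction n with
  | zero => simp [stepTwoFactorial]
  | succ n ih =>
    rw [stepTwoFactorial_succ_right, Nat.factorial_succ, pow_succ]
    calc _ ≤ 2 ^ n * n.factorial * (2 * (n + 1)) := Nat.mul_le_mul ih (by omega)
      _ = _ := by ring

/-- The majorant system `B_k' = B_{k+1} B_0`, `B_k(0) = C M^k k!` has an analytic solution. -/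
theorem le_of_binomial_recursion {b : ℕ → ℕ → ℝ≥0∞} {C M : ℝ≥0∞}
    (h0 : ∀ k, b k 0 ≤ C * M ^ k * k.factorial)
    (hs : ∀ k n, b k (n + 1) ≤ ∑ p ∈ Finset.HasAntidiagonal.antidiagonal n,
      (n.choose p.1 : ℝ≥0∞) * (b (k + 1) p.1 * b 0 p.2)) (n : ℕ) :
    ∀ k, b k n ≤ C * M ^ k * k.factorial * (M * C) ^ n * stepTwoFactorial n (k + 1) := by
  -- The bounds are the Taylor coefficients, times `n!`, of `B_k(t) = C Mᵏ k! (1 -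
  -- 2MCt)^(-(k+1)/2)`, which solves the majorant system.
  induction n using Nat.strong_induction_on with
  | _ n ih =>
    intro k
    rcases n with _ | n
    · simpa [stepTwoFactorial] using h0 k
    · refine (hs k n).trans ?_
      calc _ ≤ ∑ p ∈ Finset.HasAntidiagonal.antidiagonal n,
            C * M ^ k * k.factorial * (M * C) ^ (n + 1) * (k + 1) *
            ((n.choose p.1 * (stepTwoFactorial p.1 (k + 2) * stepTwoFactorial p.2 1) : ℕ)
              : ℝ≥0∞) := by
            refine Finset.sum_le_sum fun p hp => ?_
            rw [Finset.HasAntidiagonal.mem_antidiagonal] at hp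
            calc _ ≤ (n.choose p.1 : ℝ≥0∞) * ((C * M ^ (k + 1) * (k + 1).factorial *
                  (M * C) ^ p.1 * stepTwoFactorial p.1 (k + 1 + 1)) *
                  (C * M ^ 0 * (Nat.factorial 0) * (M * C) ^ p.2 *
                    stepTwoFactorial p.2 (0 + 1))) := by
                  gcongr
                  · exact ih p.1 (by omega) (k + 1)
                  · exact ih p.2 (by omega) 0
              _ = _ := by
                  rw [← hp]
                  simp only [Nat.factorial_succ, Nat.factorial_zero]
                  push_cast
                  ring
        -- Vandermonde with `s = k + 2`, `t = 1` gives the product starting at `k + 3`; the factor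
        -- `k + 1` is the missing first term.
        _ = _ := by
            rw [← Finset.mul_sum, ← Nat.cast_sum, sum_choose_mul_stepTwoFactorial,
              stepTwoFactorial_succ_left]
            push_cast
            rw [show k + 2 + 1 = k + 1 + 2 by ring]
            ring

/-- Weighted `L¹` bounds for a convolution, for a subadditive weight. -/
theorem lintegral_pow_mul_convolution_le {E : Type*} [AddCommGroup E] [MeasurableSpace E]
    [MeasurableAdd₂ E] [MeasurableNeg E] {μ : Measure E} [SFinite μ] [μ.IsAddLeftInvariant]
    [μ.IsAddRightInvariant]
    {w : E → ℝ≥0∞} (hw : Measurable w) (hadd : ∀ x y, w (x + y) ≤ w x + w y)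
    {F G : E → ℝ≥0∞} (hF : Measurable F) (hG : Measurable G) (n : ℕ) :
    ∫⁻ x, w x ^ n * ∫⁻ y, F (x - y) * G y ∂μ ∂μ ≤
      ∑ p ∈ Finset.HasAntidiagonal.antidiagonal n, (n.choose p.1 : ℝ≥0∞) *
        ((∫⁻ x, w x ^ p.1 * F x ∂μ) * ∫⁻ x, w x ^ p.2 * G x ∂μ) := by
  have hsub : Measurable fun z : E × E => z.1 - z.2 := by
    simp only [sub_eq_add_neg]; fun_prop
  calc _ = ∫⁻ x, ∫⁻ y, w x ^ n * (F (x - y) * G y) ∂μ ∂μ := by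
        refine lintegral_congr fun x => (lintegral_const_mul _ ?_).symm
        exact (hF.comp (hsub.comp (measurable_const.prodMk measurable_id))).mul hG
    _ ≤ ∫⁻ x, ∫⁻ y, ∑ p ∈ Finset.HasAntidiagonal.antidiagonal n, (n.choose p.1 : ℝ≥0∞) *
          ((w (x - y) ^ p.1 * F (x - y)) * (w y ^ p.2 * G y)) ∂μ ∂μ := by
        refine lintegral_mono fun x => lintegral_mono fun y => ?_
        -- The weight is split between the two factors and expanded binomially; Tonelli and
        -- translation invariance then separate the integrals.
        calc _ ≤ (w (x - y) + w y) ^ n * (F (x - y) * G y) := by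
              gcongr
              simpa using hadd (x - y) y
          _ = _ := by
              rw [add_pow, ← Finset.Nat.sum_antidiagonal_eq_sum_range_succ
                (fun i j => w (x - y) ^ i * w y ^ j * (n.choose i : ℝ≥0∞)), Finset.sum_mul]
              exact Finset.sum_congr rfl fun p _ => by ring
    _ = ∫⁻ y, ∫⁻ x, ∑ p ∈ Finset.HasAntidiagonal.antidiagonal n, (n.choose p.1 : ℝ≥0∞) *
          ((w (x - y) ^ p.1 * F (x - y)) * (w y ^ p.2 * G y)) ∂μ ∂μ := by
        refine lintegral_lintegral_swap (Measurable.aemeasurable ?_)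
        refine Finset.measurable_sum _ fun p _ => measurable_const.mul (Measurable.mul ?_ ?_)
        · exact ((hw.comp hsub).pow_const _).mul (hF.comp hsub)
        · exact ((hw.comp measurable_snd).pow_const _).mul (hG.comp measurable_snd)
    _ = ∫⁻ y, ∑ p ∈ Finset.HasAntidiagonal.antidiagonal n, (n.choose p.1 : ℝ≥0∞) *
          ((∫⁻ x, w x ^ p.1 * F x ∂μ) * (w y ^ p.2 * G y)) ∂μ := by
        refine lintegral_congr fun y => ?_
        have hy : Measurable fun x : E => x - y :=
          hsub.comp (measurable_id.prodMk measurable_const)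
        have hm : ∀ i, Measurable fun x => w (x - y) ^ i * F (x - y) := fun i =>
          ((hw.comp hy).pow_const _).mul (hF.comp hy)
        rw [lintegral_finsetSum _ fun p _ => ((hm _).mul_const _).const_mul _]
        refine Finset.sum_congr rfl fun p _ => ?_
        rw [lintegral_const_mul _ ((hm _).mul_const _), lintegral_mul_const _ (hm _),
          lintegral_sub_right_eq_self (fun x => w x ^ p.1 * F x) y]
    _ = _ := by
        have hm : ∀ i, Measurable fun x => w x ^ i * G x := fun i =>
          (hw.pow_const _).mul hG
        rw [lintegral_finsetSum _ fun p _ => ((hm _).const_mul _).const_mul _]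
        refine Finset.sum_congr rfl fun p _ => ?_
        rw [lintegral_const_mul _ ((hm _).const_mul _), lintegral_const_mul _ (hm _)]

/-! ### Fourier transforms tested against Schwartz functions. -/

section FourierPair

open scoped LineDeriv

variable {E : Type*} [NormedAddCommGroup E] [InnerProductSpace ℝ E] [FiniteDimensional ℝ E]
  [MeasurableSpace E] [BorelSpace E]

/-- `U` is the Fourier transform of `u` in the sense of tempered distributions. -/
def IsFourierPair (u U : E → ℂ) : Prop :=
  ∀ χ : 𝓢(E, ℂ), ∫ x, (𝓕 χ) x * u x = ∫ ζ, χ ζ * U ζ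

/-- `u` is integrable against every Schwartz function. -/
def SchwartzIntegrable (u : E → ℂ) : Prop :=
  ∀ χ : 𝓢(E, ℂ), Integrable fun x => χ x * u x

theorem MeasureTheory.MemLp.schwartzIntegrable {u : E → ℂ} (hu : MemLp u 2) :
    SchwartzIntegrable u := fun χ => (χ.memLp 2).integrable_mul hu

theorem schwartzIntegrable_of_bounded {u : E → ℂ} (hu : AEStronglyMeasurable u) {A : ℝ}
    (hA : ∀ x, ‖u x‖ ≤ A) : SchwartzIntegrable u := fun χ =>
  χ.integrable.mul_bdd (c := A) hu (Filter.Eventually.of_forall hA)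

theorem MeasureTheory.Integrable.schwartzIntegrable {u : E → ℂ} (hu : Integrable u) :
    SchwartzIntegrable u := fun χ =>
  hu.bdd_mul (c := SchwartzMap.seminorm ℝ 0 0 χ) χ.continuous.aestronglyMeasurable
    (Filter.Eventually.of_forall fun x => χ.norm_le_seminorm ℝ x)

theorem MeasureTheory.MemLp.isFourierPair (u : Lp ℂ 2 (volume : Measure E)) :
    IsFourierPair u (𝓕 u : Lp ℂ 2 (volume : Measure E)) := by
  intro χ
  have h := DFunLike.congr_fun (Lp.fourier_toTemperedDistribution_eq u) χ
  simpa using h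

namespace IsFourierPair

variable {u v U V : E → ℂ}

theorem congr (h : IsFourierPair u U) (hu : u =ᵐ[volume] v) (hU : U =ᵐ[volume] V) :
    IsFourierPair v V := by
  intro χ
  have h1 : ∫ x, (𝓕 χ) x * v x = ∫ x, (𝓕 χ) x * u x :=
    integral_congr_ae (hu.mono fun x hx => by simp only [hx])
  have h2 : ∫ x, χ x * V x = ∫ x, χ x * U x :=
    integral_congr_ae (hU.mono fun x hx => by simp only [hx])
  rw [h1, h2, h χ]

theorem add (h : IsFourierPair u U) (h' : IsFourierPair v V) (hu : SchwartzIntegrable u)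
    (hv : SchwartzIntegrable v) (hU : SchwartzIntegrable U) (hV : SchwartzIntegrable V) :
    IsFourierPair (fun x => u x + v x) (fun ζ => U ζ + V ζ) := by
  intro χ
  simp only [mul_add]
  rw [integral_add (hu _) (hv _), integral_add (hU _) (hV _), h, h']

theorem const_mul (h : IsFourierPair u U) (c : ℂ) :
    IsFourierPair (fun x => c * u x) (fun ζ => c * U ζ) := by
  intro χ
  simp only [mul_left_comm _ c, integral_const_mul, h χ]

theorem ae_eq_right (h : IsFourierPair u U) (h' : IsFourierPair u V) (hU : LocallyIntegrable U)
    (hV : LocallyIntegrable V) : U =ᵐ[volume] V := by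
  refine ae_eq_of_integral_contDiff_smul_eq hU hV fun g hg hgc => ?_
  have h1 : HasCompactSupport (Complex.ofRealCLM ∘ g) := hgc.comp_left rfl
  have h2 : ContDiff ℝ ∞ (Complex.ofRealCLM ∘ g) := by fun_prop
  simpa using (h (h1.toSchwartzMap h2)).symm.trans (h' (h1.toSchwartzMap h2))

theorem ae_eq_left (h : IsFourierPair u U) (h' : IsFourierPair v U) (hu : LocallyIntegrable u)
    (hv : LocallyIntegrable v) : u =ᵐ[volume] v := by
  refine ae_eq_of_integral_contDiff_smul_eq hu hv fun g hg hgc => ?_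
  have h1 : HasCompactSupport (Complex.ofRealCLM ∘ g) := hgc.comp_left rfl
  have h2 : ContDiff ℝ ∞ (Complex.ofRealCLM ∘ g) := by fun_prop
  simpa using (h (𝓕⁻ (h1.toSchwartzMap h2))).trans (h' (𝓕⁻ (h1.toSchwartzMap h2))).symm

/-- Uniqueness identifies `U` with the `L²` transform of `u`, and Plancherel applies. -/
theorem memLp_right (h : IsFourierPair u U) (hu : MemLp u 2) (hU : LocallyIntegrable U) :
    MemLp U 2 ∧ eLpNorm U 2 volume = eLpNorm u 2 volume := by
  have hp : IsFourierPair u (𝓕 (hu.toLp u) : Lp ℂ 2 (volume : Measure E)) :=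
    (MemLp.isFourierPair (hu.toLp u)).congr hu.coeFn_toLp (ae_eq_refl _)
  have he := h.ae_eq_right hp hU ((Lp.memLp _).locallyIntegrable (by norm_num))
  refine ⟨(memLp_congr_ae he).2 (Lp.memLp _), ?_⟩
  rw [eLpNorm_congr_ae he, ← Lp.enorm_def, ← eLpNorm_congr_ae hu.coeFn_toLp, ← Lp.enorm_def,
    ← ofReal_norm, ← ofReal_norm, Lp.norm_fourier_eq]

theorem memLp_left (h : IsFourierPair u U) (hU : MemLp U 2) (hu : LocallyIntegrable u) :
    MemLp u 2 := by
  have hp : IsFourierPair (𝓕⁻ (hU.toLp U) : Lp ℂ 2 (volume : Measure E)) U := by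
    refine (MemLp.isFourierPair (𝓕⁻ (hU.toLp U))).congr (ae_eq_refl _) ?_
    rw [FourierTransform.fourier_fourierInv_eq]
    exact hU.coeFn_toLp
  exact (memLp_congr_ae (h.ae_eq_left hp hu
    ((Lp.memLp _).locallyIntegrable (by norm_num)))).2 (Lp.memLp _)

end IsFourierPair

/-- Fubini moves `𝓕⁻` from `U` onto `𝓕 χ`, where it cancels. -/
theorem isFourierPair_fourierInv {U : E → ℂ} (hU : Integrable U) : IsFourierPair (𝓕⁻ U) U := by
  intro χ
  have h := VectorFourier.integral_fourierIntegral_smul_eq_flip (μ := volume) (ν := volume)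
    (L := -(innerₗ E)) (e := Real.fourierChar) (f := U) (g := (𝓕 χ : 𝓢(E, ℂ)))
    Real.continuous_fourierChar (continuous_inner (𝕜 := ℝ) (E := E)).neg hU (𝓕 χ).integrable
  have h1 : ∀ f : E → ℂ, VectorFourier.fourierIntegral Real.fourierChar volume (-(innerₗ E)) f =
      𝓕⁻ f := fun _ => rfl
  have h2 : ∀ f : E → ℂ, VectorFourier.fourierIntegral Real.fourierChar volume
      (-(innerₗ E)).flip f = 𝓕⁻ f := by
    intro f
    ext x
    simp [VectorFourier.fourierIntegral, Real.fourierInv_eq, real_inner_comm]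
  rw [h1, h2, ← SchwartzMap.fourierInv_coe, FourierTransform.fourierInv_fourier_eq] at h
  simpa [mul_comm] using h

/-- Multiplication by the symbol `2πi⟨ζ,m⟩` of the derivative in the direction `m`. -/
noncomputable def derivSymbol (m : E) (U : E → ℂ) (ζ : E) : ℂ :=
  2 * Real.pi * Complex.I * (inner ℝ ζ m : ℝ) * U ζ

theorem fourier_derivSymbol (m : E) (χ : 𝓢(E, ℂ)) :
    ∃ χ' : 𝓢(E, ℂ), (∀ ζ, χ' ζ = -derivSymbol m χ ζ) ∧
      ∀ x, (𝓕 χ') x = fderiv ℝ (𝓕 χ : 𝓢(E, ℂ)) x m := by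
  refine ⟨-(2 * Real.pi * Complex.I) • SchwartzMap.smulLeftCLM ℂ (inner ℝ · m) χ, ?_, ?_⟩
  · intro ζ
    have : (inner ℝ · m : E → ℝ).HasTemperateGrowth := by fun_prop
    simp [this, derivSymbol, mul_assoc]
  · intro x
    rw [← SchwartzMap.lineDerivOp_fourier_eq, SchwartzMap.lineDerivOp_apply_eq_fderiv]

/-- Integration by parts puts the derivative on `𝓕 χ`, where it is again the transform of a Schwartz
function. -/
theorem IsFourierPair.fderiv {u U : E → ℂ} (h : IsFourierPair u U) (hd : Differentiable ℝ u)
    (m : E) (hu : SchwartzIntegrable u) (hu' : SchwartzIntegrable fun x => fderiv ℝ u x m) :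
    IsFourierPair (fun x => fderiv ℝ u x m) (derivSymbol m U) := by
  intro χ
  obtain ⟨χ', h1, h2⟩ := fourier_derivSymbol m χ
  have h3 : Integrable fun x => _root_.fderiv ℝ (𝓕 χ : 𝓢(E, ℂ)) x m * u x := by
    simpa only [h2] using hu (𝓕 χ')
  rw [integral_mul_fderiv_eq_neg_fderiv_mul_of_integrable h3 (hu' _) (hu _)
    (fun x _ => (𝓕 χ).differentiableAt) (fun x _ => hd x)]
  have h4 := h χ'
  simp only [h2, h1] at h4
  rw [h4, ← integral_neg]
  refine integral_congr_ae (Filter.Eventually.of_forall fun ζ => ?_)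
  simp only [derivSymbol]
  ring

end FourierPair

/-! ### Moments of a function and regularity of its inverse Fourier integral. -/

section Moments

variable {E : Type*} [NormedAddCommGroup E] [InnerProductSpace ℝ E] [FiniteDimensional ℝ E]
  [MeasurableSpace E] [BorelSpace E]

/-- All absolute moments of `U` are finite. -/
structure HasMoments (U : E → ℂ) : Prop where
  aestronglyMeasurable : AEStronglyMeasurable U
  integrable_pow : ∀ n : ℕ, Integrable fun ζ => ‖ζ‖ ^ n * ‖U ζ‖

theorem fourierInv_eq_vectorFourier {F : Type*} [NormedAddCommGroup F] [NormedSpace ℂ F]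
    (U : E → F) :
    𝓕⁻ U = VectorFourier.fourierIntegral Real.fourierChar volume
      (-innerSL ℝ : E →L[ℝ] E →L[ℝ] ℝ).toLinearMap₁₂ U := rfl

theorem norm_fourierInv_le (U : E → ℂ) (x : E) : ‖𝓕⁻ U x‖ ≤ ∫ ζ, ‖U ζ‖ :=
  VectorFourier.norm_fourierIntegral_le_integral_norm _ _ _ _ _

theorem continuous_fourierInv {U : E → ℂ} (hU : Integrable U) : Continuous (𝓕⁻ U) :=
  VectorFourier.fourierIntegral_continuous Real.continuous_fourierChar
    (continuous_inner (𝕜 := ℝ) (E := E)).neg hU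

theorem fourierInv_convolution {U V : E → ℂ} (hU : Integrable U) (hV : Integrable V) (x : E) :
    𝓕⁻ (convolution U V (ContinuousLinearMap.mul ℂ ℂ) volume) x = 𝓕⁻ U x * 𝓕⁻ V x := by
  simp only [Real.fourierInv_eq_fourier_neg]
  exact Real.fourier_mul_convolution_eq hU hV (-x)

namespace HasMoments

variable {U : E → ℂ}

theorem integrable (h : HasMoments U) : Integrable U :=
  (integrable_norm_iff h.aestronglyMeasurable).1 (by simpa using h.integrable_pow 0)

theorem contDiff (h : HasMoments U) : ContDiff ℝ ∞ (𝓕⁻ U) :=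
  VectorFourier.contDiff_fourierIntegral (-innerSL ℝ : E →L[ℝ] E →L[ℝ] ℝ)
    fun n _ => h.integrable_pow n

theorem derivSymbol (h : HasMoments U) (m : E) : HasMoments (derivSymbol m U) := by
  have hm : AEStronglyMeasurable (_root_.derivSymbol m U) := by
    refine AEStronglyMeasurable.mul (Continuous.aestronglyMeasurable ?_) h.aestronglyMeasurable
    fun_prop
  refine ⟨hm, fun n => ?_⟩
  refine ((h.integrable_pow (n + 1)).const_mul (2 * Real.pi * ‖m‖)).mono'
    ((by fun_prop : Continuous fun ζ : E => ‖ζ‖ ^ n).aestronglyMeasurable.mul hm.norm)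
    (Filter.Eventually.of_forall fun ζ => ?_)
  have := abs_real_inner_le_norm ζ m
  simp only [_root_.derivSymbol, norm_mul, Complex.norm_real, Real.norm_eq_abs, Complex.norm_I,
    Complex.norm_ofNat, abs_of_pos Real.pi_pos, mul_one, norm_pow, abs_norm]
  rw [abs_of_nonneg (by positivity), abs_abs]
  calc _ ≤ ‖ζ‖ ^ n * (2 * Real.pi * (‖ζ‖ * ‖m‖) * ‖U ζ‖) := by gcongr
    _ = _ := by ring

theorem fderiv_fourierInv (h : HasMoments U) (m x : E) :
    fderiv ℝ (𝓕⁻ U) x m = 𝓕⁻ (_root_.derivSymbol m U) x := by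
  have h1 : Integrable fun v => ‖v‖ * ‖U v‖ := by simpa using h.integrable_pow 1
  have h2 : Integrable (VectorFourier.fourierSMulRight
      (-innerSL ℝ : E →L[ℝ] E →L[ℝ] ℝ) U) := by
    refine (h1.const_mul (2 * Real.pi * ‖(-innerSL ℝ : E →L[ℝ] E →L[ℝ] ℝ)‖)).mono'
      (h.aestronglyMeasurable.fourierSMulRight) (Filter.Eventually.of_forall fun v => ?_)
    exact (VectorFourier.norm_fourierSMulRight_le _ _ _).trans (le_of_eq (by ring))
  rw [fourierInv_eq_vectorFourier, (VectorFourier.hasFDerivAt_fourierIntegral _ h.integrable h1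
    x).fderiv, Real.fourierIntegral_continuousLinearMap_apply' h2, fourierInv_eq_vectorFourier]
  congr 1
  ext v
  simp [_root_.derivSymbol, VectorFourier.fourierSMulRight_apply, innerSL_apply_apply ℝ]
  ring_nf

/-- The inverse Fourier integral of a function whose moments grow at most like `C Aⁿ n!` is real
analytic. -/
theorem analyticAt_fourierInv (h : HasMoments U) {C A : ℝ} (hA : 0 < A)
    (hC : ∀ n : ℕ, ∫ ζ, ‖ζ‖ ^ n * ‖U ζ‖ ≤ C * A ^ n * n.factorial) (x : E) :
    AnalyticAt ℝ (𝓕⁻ U) x := by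
  set L : E →L[ℝ] E →L[ℝ] ℝ := -innerSL ℝ with hL
  have hL1 : ‖L‖ ≤ 1 := by
    exact (norm_neg (innerSL ℝ : E →L[ℝ] E →L[ℝ] ℝ)).trans_le (norm_innerSL_le ℝ)
  have hint := fun n => VectorFourier.integrable_fourierPowSMulRight L (h.integrable_pow n)
    h.aestronglyMeasurable
  -- Half of the radius `1 / (2πA)`, so that the series is dominated by a geometric one of ratio
  -- `1/2`.
  set r : ℝ := (4 * Real.pi * A)⁻¹ with hr
  have hr0 : 0 < r := by positivity
  have hrA : 2 * Real.pi * A * r = 1 / 2 := by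
    rw [hr]; field_simp; norm_num
  have hC0 : 0 ≤ C := by
    have := (integral_nonneg fun ζ : E => by positivity).trans (hC 0)
    simpa using this
  let p : FormalMultilinearSeries ℝ E ℂ := fun n => ((n.factorial : ℝ)⁻¹) •
    𝓕⁻ (fun v => VectorFourier.fourierPowSMulRight L U v n) x
  have hbound : ∀ n, ∫ v, ‖VectorFourier.fourierPowSMulRight L U v n‖ ≤
      (2 * Real.pi) ^ n * (C * A ^ n * n.factorial) := by
    intro n
    calc _ ≤ ∫ v, (2 * Real.pi) ^ n * (‖v‖ ^ n * ‖U v‖) := by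
          refine integral_mono (hint n).norm ((h.integrable_pow n).const_mul _) fun v => ?_
          refine (VectorFourier.norm_fourierPowSMulRight_le L U v n).trans ?_
          rw [← mul_assoc]
          have : 2 * Real.pi * ‖L‖ ≤ 2 * Real.pi := mul_le_of_le_one_right (by positivity) hL1
          gcongr
      _ ≤ _ := by
          rw [integral_const_mul]
          gcongr
          exact hC n
  refine ⟨p, ENNReal.ofReal r, ?_, ENNReal.ofReal_pos.2 hr0, ?_⟩
  · refine p.le_radius_of_bound (r := r.toNNReal) C fun n => ?_
    have h1 : ‖p n‖ ≤ (n.factorial : ℝ)⁻¹ * ((2 * Real.pi) ^ n * (C * A ^ n * n.factorial)) := by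
      simp only [p]
      rw [norm_smul, norm_inv, Real.norm_natCast]
      gcongr
      exact (VectorFourier.norm_fourierIntegral_le_integral_norm _ _ _ _ _).trans (hbound n)
    rw [Real.coe_toNNReal _ hr0.le]
    calc _ ≤ (n.factorial : ℝ)⁻¹ * ((2 * Real.pi) ^ n * (C * A ^ n * n.factorial)) * r ^ n := by
          gcongr
      _ = C * (2 * Real.pi * A * r) ^ n := by
          field_simp
          ring_nf
      _ ≤ C * 1 := by
          rw [hrA]
          gcongr
          exact pow_le_one₀ (by norm_num) (by norm_num)
      _ = C := mul_one C
  · intro y hy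
    have hy' : ‖y‖ < r := by
      rw [Metric.mem_eball, edist_zero_right, ← ofReal_norm] at hy
      exact (ENNReal.ofReal_lt_ofReal_iff hr0).1 hy
    -- `F n` is the `n`-th term of `exp(2πi⟨v, x + y⟩) U v` expanded in powers of `y`; summable `L¹`
    -- norms justify exchanging sum and integral.
    let F : ℕ → E → ℂ := fun n v => (Real.fourierChar (inner ℝ v x) : ℂ) *
      (((n.factorial : ℝ)⁻¹ : ℝ) * VectorFourier.fourierPowSMulRight L U v n (fun _ => y))
    have hFn : ∀ n v, ‖F n v‖ ≤ (n.factorial : ℝ)⁻¹ * ‖y‖ ^ n *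
        ‖VectorFourier.fourierPowSMulRight L U v n‖ := by
      intro n v
      simp only [F, norm_mul, Circle.norm_coe, one_mul, Complex.norm_real, norm_inv,
        Real.norm_natCast]
      rw [mul_assoc]
      gcongr
      refine (ContinuousMultilinearMap.le_opNorm _ _).trans ?_
      simp [mul_comm]
    have hFi : ∀ n, Integrable (F n) := by
      intro n
      refine ((hint n).norm.const_mul ((n.factorial : ℝ)⁻¹ * ‖y‖ ^ n)).mono' ?_
        (Filter.Eventually.of_forall (hFn n))
      refine AEStronglyMeasurable.mul (Continuous.aestronglyMeasurable ?_)
        (AEStronglyMeasurable.const_mul ?_ _)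
      · exact continuous_subtype_val.comp (Real.continuous_fourierChar.comp (by fun_prop))
      · exact (ContinuousMultilinearMap.apply ℝ (fun _ : Fin n => E) ℂ
          (fun _ => y)).continuous.comp_aestronglyMeasurable (hint n).aestronglyMeasurable
    have hsum : Summable fun n => ∫ v, ‖F n v‖ := by
      refine Summable.of_nonneg_of_le (fun n => integral_nonneg fun v => norm_nonneg _)
        (fun n => ?_) ((summable_geometric_of_lt_one (r := 1 / 2) (by norm_num)
          (by norm_num)).mul_left C)
      calc _ ≤ ∫ v, (n.factorial : ℝ)⁻¹ * ‖y‖ ^ n *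
            ‖VectorFourier.fourierPowSMulRight L U v n‖ :=
            integral_mono (hFi n).norm ((hint n).norm.const_mul _) (hFn n)
        _ ≤ (n.factorial : ℝ)⁻¹ * r ^ n * ((2 * Real.pi) ^ n * (C * A ^ n * n.factorial)) := by
            rw [integral_const_mul]
            gcongr
            exact hbound n
        _ = C * (2 * Real.pi * A * r) ^ n := by
            field_simp
            ring_nf
        _ = _ := by rw [hrA]
    have hmain := hasSum_integral_of_summable_integral_norm hFi hsum
    convert hmain using 1
    · ext n
      simp only [p, F, smul_apply]
      rw [fourierInv_eq_vectorFourier, ← hL,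
        Real.fourierIntegral_continuousMultilinearMap_apply' (hint n),
        VectorFourier.fourierIntegral, ← integral_smul]
      refine integral_congr_ae (Filter.Eventually.of_forall fun v => ?_)
      simp only [hL, Circle.smul_def, Complex.real_smul, smul_eq_mul]
      simp [innerSL_apply_apply ℝ]
      ring_nf
    · rw [Real.fourierInv_eq]
      refine integral_congr_ae (Filter.Eventually.of_forall fun v => ?_)
      -- The sign of `L = -⟨·,·⟩` cancels that of the forward transform convention `(-2πi)ⁿ`.
      have hterm : ∀ n, F n v = (Real.fourierChar (inner ℝ v x) : ℂ) * U v *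
          (((n.factorial : ℂ)⁻¹) • (2 * Real.pi * Complex.I * (inner ℝ v y : ℝ)) ^ n) := by
        intro n
        simp only [F, VectorFourier.fourierPowSMulRight_apply, hL]
        simp [mul_pow, innerSL_apply_apply ℝ, neg_pow (2 * Real.pi * Complex.I : ℂ)]
        have : ((-1 : ℂ) ^ n) * (-1) ^ n = 1 := by rw [← mul_pow]; simp
        linear_combination ((Real.fourierChar (inner ℝ v x) : ℂ) * U v * (n.factorial : ℂ)⁻¹ *
          (2 ^ n * Real.pi ^ n * Complex.I ^ n * (inner ℝ v y : ℝ) ^ n)) * this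
      have hexp := (NormedSpace.exp_series_hasSum_exp' (𝕂 := ℂ)
        (2 * Real.pi * Complex.I * (inner ℝ v y : ℝ) : ℂ)).mul_left
        ((Real.fourierChar (inner ℝ v x) : ℂ) * U v)
      simp only [hterm]
      rw [hexp.tsum_eq, ← Complex.exp_eq_exp_ℂ, inner_add_right, AddChar.map_add_eq_mul,
        Circle.smul_def, Circle.coe_mul, Real.fourierChar_apply (inner ℝ v y), smul_eq_mul]
      push_cast
      ring_nf

end HasMoments

end Moments

/-! ### Derivative symbols and square-integrable moments. -/

section DerivSymbol

theorem norm_derivSymbol {E : Type*} [NormedAddCommGroup E] [InnerProductSpace ℝ E]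
    (m : E) (U : E → ℂ) (ζ : E) :
    ‖derivSymbol m U ζ‖ = 2 * Real.pi * |inner ℝ ζ m| * ‖U ζ‖ := by
  simp [derivSymbol, abs_of_pos Real.pi_pos]

theorem norm_derivSymbol_le {E : Type*} [NormedAddCommGroup E] [InnerProductSpace ℝ E]
    (m : E) (U : E → ℂ) (ζ : E) :
    ‖derivSymbol m U ζ‖ ≤ 2 * Real.pi * ‖m‖ * (‖ζ‖ * ‖U ζ‖) := by
  rw [norm_derivSymbol]
  have := abs_real_inner_le_norm ζ m
  calc _ ≤ 2 * Real.pi * (‖ζ‖ * ‖m‖) * ‖U ζ‖ := by gcongr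
    _ = _ := by ring

variable {E : Type*} [NormedAddCommGroup E] [InnerProductSpace ℝ E] [FiniteDimensional ℝ E]
  [MeasurableSpace E] [BorelSpace E]

theorem SchwartzIntegrable.add {U V : E → ℂ} (hU : SchwartzIntegrable U)
    (hV : SchwartzIntegrable V) : SchwartzIntegrable fun x => U x + V x := fun χ => by
  simp only [mul_add]
  exact (hU χ).add (hV χ)

theorem SchwartzIntegrable.derivSymbol {U : E → ℂ} (h : SchwartzIntegrable U) (m : E) :
    SchwartzIntegrable (derivSymbol m U) := by
  intro χ
  obtain ⟨χ', h1, -⟩ := fourier_derivSymbol m χ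
  refine (h χ').neg.congr (Filter.Eventually.of_forall fun ζ => ?_)
  simp only [h1, _root_.derivSymbol, Pi.neg_apply]
  ring

theorem locallyIntegrable_derivSymbol {U : E → ℂ} (h : LocallyIntegrable U) (m : E) :
    LocallyIntegrable (derivSymbol m U) :=
  LocallyIntegrable.continuous_mul (g := fun ζ => 2 * Real.pi * Complex.I * (inner ℝ ζ m : ℝ))
    (by fun_prop) h

/-- `U` has finite moments of all orders, in `L¹` and in `L²`. -/
structure HasSquareMoments (U : E → ℂ) : Prop extends HasMoments U where
  memLp_pow : ∀ n : ℕ, MemLp (fun ζ => ‖ζ‖ ^ n * ‖U ζ‖) 2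

namespace HasSquareMoments

variable {U : E → ℂ}

theorem memLp (h : HasSquareMoments U) : MemLp U 2 :=
  (memLp_norm_iff h.aestronglyMeasurable).1 (by simpa using h.memLp_pow 0)

theorem derivSymbol (h : HasSquareMoments U) (m : E) : HasSquareMoments (derivSymbol m U) where
  toHasMoments := h.toHasMoments.derivSymbol m
  memLp_pow n := by
    refine ((h.memLp_pow (n + 1)).const_mul (2 * Real.pi * ‖m‖)).mono
      ((by fun_prop : Continuous fun ζ : E => ‖ζ‖ ^ n).aestronglyMeasurable.mul
        (h.toHasMoments.derivSymbol m).aestronglyMeasurable.norm)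
      (Filter.Eventually.of_forall fun ζ => ?_)
    rw [Real.norm_of_nonneg (by positivity), Real.norm_of_nonneg (by positivity)]
    calc _ ≤ ‖ζ‖ ^ n * (2 * Real.pi * ‖m‖ * (‖ζ‖ * ‖U ζ‖)) := by
          gcongr
          exact norm_derivSymbol_le m U ζ
      _ = _ := by ring

theorem memLp_fourierInv (h : HasSquareMoments U) : MemLp (𝓕⁻ U) 2 :=
  (isFourierPair_fourierInv h.integrable).memLp_left h.memLp
    (continuous_fourierInv h.integrable).locallyIntegrable

end HasSquareMoments

end DerivSymbol

/-! ### From weighted `L²` to `L¹` in two dimensions. -/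

section Plane

theorem memLp_one_add_norm_sq_inv :
    MemLp (fun ζ : Plane => (1 + ‖ζ‖ ^ 2)⁻¹) 2 := by
  have hc : Continuous fun ζ : Plane => (1 + ‖ζ‖ ^ 2)⁻¹ :=
    (by fun_prop : Continuous fun ζ : Plane => 1 + ‖ζ‖ ^ 2).inv₀ fun ζ => by positivity
  rw [memLp_two_iff_integrable_sq hc.aestronglyMeasurable]
  have h := integrable_rpow_neg_one_add_norm_sq (E := Plane) (μ := volume) (r := 4)
    (by simp; norm_num)
  refine h.congr (Filter.Eventually.of_forall fun ζ => ?_)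
  simp only
  rw [show (-4 / 2 : ℝ) = -((2 : ℕ) : ℝ) by norm_num, Real.rpow_neg (by positivity),
    Real.rpow_natCast, inv_pow]

/-- The `L²` norm of `(1 + |ζ|²)⁻¹` on the plane. -/
noncomputable def kernelNorm : ℝ≥0∞ := eLpNorm (fun ζ : Plane => (1 + ‖ζ‖ ^ 2)⁻¹) 2

theorem kernelNorm_lt_top : kernelNorm < ⊤ := memLp_one_add_norm_sq_inv.2

theorem lintegral_enorm_mul_le {α : Type*} {m : MeasurableSpace α} {μ : Measure α} {f g : α → ℝ}
    (hf : AEStronglyMeasurable f μ) (hg : AEStronglyMeasurable g μ) :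
    ∫⁻ x, ‖g x * f x‖ₑ ∂μ ≤ eLpNorm g 2 μ * eLpNorm f 2 μ := by
  have h := eLpNorm_smul_le_mul_eLpNorm (p := 2) (q := 2) (r := 1) hf hg
  rwa [eLpNorm_one_eq_lintegral_enorm] at h

/-- Cauchy–Schwarz against `(1 + |ζ|²)⁻¹`, which is square integrable in dimension two: two
derivatives in `L²` give an integrable transform. -/
theorem lintegral_enorm_le_kernelNorm_mul {F G : Type*} [NormedAddCommGroup F]
    [NormedAddCommGroup G] {U : Plane → F} {V : Plane → G} (hV : AEStronglyMeasurable V)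
    (h : ∀ ζ, (1 + ‖ζ‖ ^ 2) * ‖U ζ‖ ≤ ‖V ζ‖) :
    ∫⁻ ζ, ‖U ζ‖ₑ ≤ kernelNorm * eLpNorm V 2 := by
  have hK := memLp_one_add_norm_sq_inv.aestronglyMeasurable
  have hle := lintegral_enorm_mul_le hV.norm hK
  rw [eLpNorm_norm] at hle
  refine le_trans (lintegral_mono fun ζ => ?_) hle
  rw [← ofReal_norm, ← ofReal_norm]
  refine ENNReal.ofReal_le_ofReal ?_
  rw [Real.norm_of_nonneg (by positivity), inv_mul_eq_div, le_div_iff₀ (by positivity), mul_comm]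
  exact h ζ

/-- The standard basis vectors of the plane. -/
noncomputable def planeBasis (j : Fin 2) : Plane := EuclideanSpace.single j 1

theorem inner_planeBasis (ζ : Plane) (j : Fin 2) : inner ℝ ζ (planeBasis j) = ζ j := by
  simp [planeBasis, EuclideanSpace.inner_single_right]

end Plane

/-! ### Derivatives and `L²` bounds of `f⁽ᵏ⁾(φ) - f⁽ᵏ⁾(0)`. -/

section Composition

/-- `φ` is the real function whose Fourier transform is the rapidly decaying function `Φ`. -/
structure IsTameProfile (φ : Plane → ℝ) (Φ : Plane → ℂ) : Prop extends HasSquareMoments Φ where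
  ofReal_eq : ∀ x, (φ x : ℂ) = 𝓕⁻ Φ x

namespace IsTameProfile

variable {φ : Plane → ℝ} {Φ : Plane → ℂ}

theorem eq_re (h : IsTameProfile φ Φ) : φ = fun x => Complex.reCLM (𝓕⁻ Φ x) := by
  ext x
  simp [← h.ofReal_eq]

theorem contDiff (h : IsTameProfile φ Φ) : ContDiff ℝ ∞ φ := by
  rw [h.eq_re]
  exact Complex.reCLM.contDiff.comp h.toHasMoments.contDiff

theorem differentiable (h : IsTameProfile φ Φ) : Differentiable ℝ φ :=
  h.contDiff.differentiable (by simp)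

theorem fderiv_apply (h : IsTameProfile φ Φ) (m : Plane) :
    IsTameProfile (fun x => fderiv ℝ φ x m) (derivSymbol m Φ) where
  toHasSquareMoments := h.toHasSquareMoments.derivSymbol m
  ofReal_eq x := by
    rw [← h.toHasMoments.fderiv_fourierInv, ← funext h.ofReal_eq]
    have h1 := (Complex.ofRealCLM.hasFDerivAt (x := φ x)).comp x (h.differentiable x).hasFDerivAt
    have h2 : fderiv ℝ (fun x => (φ x : ℂ)) x = Complex.ofRealCLM ∘L fderiv ℝ φ x := h1.fderiv
    rw [h2]
    rfl

theorem abs_le (h : IsTameProfile φ Φ) (x : Plane) : |φ x| ≤ ∫ ζ, ‖Φ ζ‖ := by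
  rw [← Real.norm_eq_abs, ← Complex.norm_real, h.ofReal_eq]
  exact norm_fourierInv_le Φ x

theorem memLp_two (h : IsTameProfile φ Φ) : MemLp φ 2 := by
  have h1 := h.memLp_fourierInv
  rw [← funext h.ofReal_eq] at h1
  exact h1.re

end IsTameProfile

/-- The function `f⁽ᵏ⁾(φ) - f⁽ᵏ⁾(0)`, regarded as complex valued. -/
noncomputable def compDeriv (f : ℝ → ℝ) (φ : Plane → ℝ) (k : ℕ) (x : Plane) : ℂ :=
  ((iteratedDeriv k f (φ x) - iteratedDeriv k f 0 : ℝ) : ℂ)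

theorem hasDerivAt_iteratedDeriv {f : ℝ → ℝ} (hf : ContDiff ℝ ∞ f) (k : ℕ) (t : ℝ) :
    HasDerivAt (iteratedDeriv k f) (iteratedDeriv (k + 1) f t) t := by
  rw [iteratedDeriv_succ]
  exact (hf.differentiable_iteratedDeriv k (mod_cast ENat.natCast_lt_top k) t).hasDerivAt

variable {f : ℝ → ℝ} {φ : Plane → ℝ} {Φ : Plane → ℂ} {R M : ℝ}

theorem hasFDerivAt_iteratedDeriv_comp (hf : ContDiff ℝ ∞ f) (h : IsTameProfile φ Φ) (k : ℕ)
    (x : Plane) : HasFDerivAt (fun x => iteratedDeriv k f (φ x))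
      (iteratedDeriv (k + 1) f (φ x) • fderiv ℝ φ x) x :=
  (hasDerivAt_iteratedDeriv hf k (φ x)).comp_hasFDerivAt x (h.differentiable x).hasFDerivAt

theorem hasFDerivAt_compDeriv (hf : ContDiff ℝ ∞ f) (h : IsTameProfile φ Φ) (k : ℕ)
    (x : Plane) : HasFDerivAt (compDeriv f φ k)
      (Complex.ofRealCLM ∘L (iteratedDeriv (k + 1) f (φ x) • fderiv ℝ φ x)) x :=
  Complex.ofRealCLM.hasFDerivAt.comp x ((hasFDerivAt_iteratedDeriv_comp hf h k x).sub_const _)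

theorem fderiv_compDeriv (hf : ContDiff ℝ ∞ f) (h : IsTameProfile φ Φ) (k : ℕ) (x m : Plane) :
    fderiv ℝ (compDeriv f φ k) x m =
      ((iteratedDeriv (k + 1) f (φ x) * fderiv ℝ φ x m : ℝ) : ℂ) := by
  rw [(hasFDerivAt_compDeriv hf h k x).fderiv]
  rfl

theorem hasFDerivAt_fderiv_compDeriv (hf : ContDiff ℝ ∞ f) (h : IsTameProfile φ Φ) (k : ℕ)
    (x m : Plane) : HasFDerivAt (fun x => fderiv ℝ (compDeriv f φ k) x m)
      (Complex.ofRealCLM ∘L (iteratedDeriv (k + 1) f (φ x) • fderiv ℝ (fun x => fderiv ℝ φ x m) x +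
        fderiv ℝ φ x m • (iteratedDeriv (k + 2) f (φ x) • fderiv ℝ φ x))) x := by
  simp only [fderiv_compDeriv hf h]
  exact Complex.ofRealCLM.hasFDerivAt.comp x ((hasFDerivAt_iteratedDeriv_comp hf h (k + 1) x).mul
    ((h.fderiv_apply m).differentiable x).hasFDerivAt)

theorem fderiv_fderiv_compDeriv (hf : ContDiff ℝ ∞ f) (h : IsTameProfile φ Φ) (k : ℕ)
    (x m : Plane) : fderiv ℝ (fun x => fderiv ℝ (compDeriv f φ k) x m) x m =
      ((iteratedDeriv (k + 1) f (φ x) * fderiv ℝ (fun x => fderiv ℝ φ x m) x m +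
        fderiv ℝ φ x m * (iteratedDeriv (k + 2) f (φ x) * fderiv ℝ φ x m) : ℝ) : ℂ) := by
  rw [(hasFDerivAt_fderiv_compDeriv hf h k x m).fderiv]
  rfl

theorem continuous_iteratedDeriv_comp (hf : ContDiff ℝ ∞ f) (h : IsTameProfile φ Φ) (k : ℕ) :
    Continuous fun x => iteratedDeriv k f (φ x) :=
  (hf.continuous_iteratedDeriv k (mod_cast le_top)).comp h.contDiff.continuous

theorem continuous_compDeriv (hf : ContDiff ℝ ∞ f) (h : IsTameProfile φ Φ) (k : ℕ) :
    Continuous (compDeriv f φ k) :=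
  Complex.continuous_ofReal.comp ((continuous_iteratedDeriv_comp hf h k).sub continuous_const)

theorem continuous_fderiv_compDeriv (hf : ContDiff ℝ ∞ f) (h : IsTameProfile φ Φ) (k : ℕ)
    (m : Plane) : Continuous fun x => fderiv ℝ (compDeriv f φ k) x m :=
  Differentiable.continuous fun x => (hasFDerivAt_fderiv_compDeriv hf h k x m).differentiableAt

theorem continuous_fderiv_fderiv_compDeriv (hf : ContDiff ℝ ∞ f) (h : IsTameProfile φ Φ) (k : ℕ)
    (m : Plane) :
    Continuous fun x => fderiv ℝ (fun x => fderiv ℝ (compDeriv f φ k) x m) x m := by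
  simp only [fderiv_fderiv_compDeriv hf h]
  have h1 := h.fderiv_apply m
  refine Complex.continuous_ofReal.comp ?_
  exact ((continuous_iteratedDeriv_comp hf h _).mul (h1.fderiv_apply m).contDiff.continuous).add
    (h1.contDiff.continuous.mul
      ((continuous_iteratedDeriv_comp hf h _).mul h1.contDiff.continuous))

/-- Lets derivatives of `f` of different orders share the bound of the highest one; this is where `1
≤ M` matters. -/
theorem pow_mul_factorial_mono (hM1 : 1 ≤ M) {a b : ℕ} (hab : a ≤ b) :
    M ^ (a + 1) * (a.factorial : ℝ) ≤ M ^ (b + 1) * (b.factorial : ℝ) := by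
  have := Nat.factorial_le hab
  gcongr

/-- Mean value inequality between `0` and `φ x`. Subtracting `f⁽ᵏ⁾(0)` is what makes the function
`O(|φ|)`, hence square integrable. -/
theorem norm_compDeriv_le (hf : ContDiff ℝ ∞ f) (hR : ∀ x, |φ x| < R)
    (hM : ∀ t, |t| < R → ∀ n : ℕ, |iteratedDeriv n f t| ≤ M ^ (n + 1) * (n.factorial : ℝ))
    (k : ℕ) (x : Plane) :
    ‖compDeriv f φ k x‖ ≤ M ^ (k + 2) * ((k + 1).factorial : ℝ) * |φ x| := by
  rw [compDeriv, Complex.norm_real]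
  have h0 : (0 : ℝ) ∈ Set.Ioo (-R) R := by
    have := (abs_nonneg _).trans_lt (hR x)
    exact ⟨by linarith, this⟩
  have h := (convex_Ioo (-R) R).norm_image_sub_le_of_norm_hasDerivWithin_le
    (f := iteratedDeriv k f) (f' := iteratedDeriv (k + 1) f)
    (C := M ^ (k + 2) * ((k + 1).factorial : ℝ))
    (fun t _ => (hasDerivAt_iteratedDeriv hf k t).hasDerivWithinAt)
    (fun t ht => hM t (abs_lt.2 ht) (k + 1)) h0 (abs_lt.1 (hR x))
  simpa using h

/-- The function dominating `u - Δu` for `u = f⁽ᵏ⁾(φ) - f⁽ᵏ⁾(0)`. -/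
noncomputable def profileMajorant (φ : Plane → ℝ) (B : ℝ) (x : Plane) : ℝ :=
  |φ x| + ∑ j : Fin 2, (B * |fderiv ℝ φ x (planeBasis j)| +
    |fderiv ℝ (fun x => fderiv ℝ φ x (planeBasis j)) x (planeBasis j)|)

theorem memLp_profileMajorant (h : IsTameProfile φ Φ) (B : ℝ) :
    MemLp (profileMajorant φ B) 2 := by
  refine h.memLp_two.norm.add (memLp_finsetSum _ fun j _ => ?_)
  exact ((h.fderiv_apply _).memLp_two.norm.const_mul B).add
    ((h.fderiv_apply _).fderiv_apply _).memLp_two.norm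

/-- The function `u - Δu` for `u = f⁽ᵏ⁾(φ) - f⁽ᵏ⁾(0)`. -/
noncomputable def compDerivSubLaplacian (f : ℝ → ℝ) (φ : Plane → ℝ) (k : ℕ) (x : Plane) : ℂ :=
  compDeriv f φ k x +
    ((-1) * fderiv ℝ (fun x => fderiv ℝ (compDeriv f φ k) x (planeBasis 0)) x (planeBasis 0) +
    (-1) * fderiv ℝ (fun x => fderiv ℝ (compDeriv f φ k) x (planeBasis 1)) x (planeBasis 1))

/-- In the term `f⁽ᵏ⁺²⁾(φ)(∂φ)²` one factor `∂φ` is bounded by `B`, so that the other stays in `L²`.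
-/
theorem norm_fderiv_fderiv_compDeriv_le (hf : ContDiff ℝ ∞ f) (h : IsTameProfile φ Φ)
    (hR : ∀ x, |φ x| < R) (hM1 : 1 ≤ M)
    (hM : ∀ t, |t| < R → ∀ n : ℕ, |iteratedDeriv n f t| ≤ M ^ (n + 1) * (n.factorial : ℝ))
    {B : ℝ} (m : Plane) (hB : ∀ x, |fderiv ℝ φ x m| ≤ B) (k : ℕ) (x : Plane) :
    ‖fderiv ℝ (fun x => fderiv ℝ (compDeriv f φ k) x m) x m‖ ≤
      M ^ (k + 3) * ((k + 2).factorial : ℝ) * (B * |fderiv ℝ φ x m| +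
        |fderiv ℝ (fun x => fderiv ℝ φ x m) x m|) := by
  rw [fderiv_fderiv_compDeriv hf h, Complex.norm_real, Real.norm_eq_abs]
  have h1 := (hM _ (hR x) (k + 1)).trans
    (pow_mul_factorial_mono hM1 (show k + 1 ≤ k + 2 by omega))
  have h2 := hM _ (hR x) (k + 2)
  refine (abs_add_le _ _).trans ?_
  rw [abs_mul, abs_mul, abs_mul]
  calc _ ≤ M ^ (k + 2 + 1) * ((k + 2).factorial : ℝ) *
          |fderiv ℝ (fun x => fderiv ℝ φ x m) x m| +
        B * (M ^ (k + 2 + 1) * ((k + 2).factorial : ℝ) * |fderiv ℝ φ x m|) := by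
        gcongr
        · exact (abs_nonneg _).trans (hB x)
        · exact hB x
    _ = _ := by ring

/-- All dependence on `k` sits in the scalar; the remaining factor is one fixed `L²` function. -/
theorem norm_compDerivSubLaplacian_le (hf : ContDiff ℝ ∞ f) (h : IsTameProfile φ Φ)
    (hR : ∀ x, |φ x| < R) (hM1 : 1 ≤ M)
    (hM : ∀ t, |t| < R → ∀ n : ℕ, |iteratedDeriv n f t| ≤ M ^ (n + 1) * (n.factorial : ℝ))
    {B : ℝ} (hB : ∀ j x, |fderiv ℝ φ x (planeBasis j)| ≤ B) (k : ℕ) (x : Plane) :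
    ‖compDerivSubLaplacian f φ k x‖ ≤
      M ^ (k + 3) * ((k + 2).factorial : ℝ) * profileMajorant φ B x := by
  have h0 := norm_compDeriv_le hf hR hM k x
  have h1 := fun j => norm_fderiv_fderiv_compDeriv_le hf h hR hM1 hM (planeBasis j) (hB j) k x
  have h2 := mul_le_mul_of_nonneg_right
    (pow_mul_factorial_mono hM1 (show k + 1 ≤ k + 2 by omega)) (abs_nonneg (φ x))
  rw [compDerivSubLaplacian, profileMajorant, Fin.sum_univ_two, mul_add, mul_add]
  refine (norm_add_le _ _).trans (add_le_add (h0.trans h2) ((norm_add_le _ _).trans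
    (add_le_add ?_ ?_)))
  · simpa using h1 0
  · simpa using h1 1

end Composition

/-! ### Size of the transforms `U_k` and the chain rule between them. -/

section Transforms

/-- `φ` is tame with values in `(-R, R)`, where the derivatives of `f` satisfy analytic bounds. -/
structure IsTameComposition (f : ℝ → ℝ) (φ : Plane → ℝ) (Φ : Plane → ℂ) (R M : ℝ) : Prop where
  contDiff : ContDiff ℝ ∞ f
  tame : IsTameProfile φ Φ
  abs_lt : ∀ x, |φ x| < R
  one_le : 1 ≤ M
  bound : ∀ t, |t| < R → ∀ n : ℕ, |iteratedDeriv n f t| ≤ M ^ (n + 1) * (n.factorial : ℝ)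

namespace IsTameComposition

variable {f : ℝ → ℝ} {φ : Plane → ℝ} {Φ : Plane → ℂ} {R M : ℝ}

theorem bound_zero (D : IsTameComposition f φ Φ R M) (n : ℕ) :
    |iteratedDeriv n f 0| ≤ M ^ (n + 1) * (n.factorial : ℝ) :=
  D.bound 0 (by simpa using (abs_nonneg _).trans_lt (D.abs_lt 0)) n

theorem memLp_compDeriv (D : IsTameComposition f φ Φ R M) (k : ℕ) :
    MemLp (compDeriv f φ k) 2 :=
  D.tame.memLp_two.of_le_mul (continuous_compDeriv D.contDiff D.tame k).aestronglyMeasurable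
    (Filter.Eventually.of_forall (norm_compDeriv_le D.contDiff D.abs_lt D.bound k))

theorem memLp_fderiv_compDeriv (D : IsTameComposition f φ Φ R M) (k : ℕ) (m : Plane) :
    MemLp (fun x => fderiv ℝ (compDeriv f φ k) x m) 2 := by
  refine (D.tame.fderiv_apply m).memLp_two.of_le_mul
    (continuous_fderiv_compDeriv D.contDiff D.tame k m).aestronglyMeasurable
    (c := M ^ (k + 2) * ((k + 1).factorial : ℝ)) (Filter.Eventually.of_forall fun x => ?_)
  rw [fderiv_compDeriv D.contDiff D.tame, Complex.norm_real, norm_mul]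
  gcongr
  exact D.bound _ (D.abs_lt x) (k + 1)

theorem exists_fderiv_bound (D : IsTameComposition f φ Φ R M) :
    ∃ B, ∀ j x, |fderiv ℝ φ x (planeBasis j)| ≤ B := by
  refine ⟨∑ j, ∫ ζ, ‖derivSymbol (planeBasis j) Φ ζ‖, fun j x =>
    ((D.tame.fderiv_apply _).abs_le x).trans ?_⟩
  exact Finset.single_le_sum (f := fun j => ∫ ζ, ‖derivSymbol (planeBasis j) Φ ζ‖)
    (fun j _ => integral_nonneg fun _ => norm_nonneg _) (Finset.mem_univ j)

theorem memLp_fderiv_fderiv_compDeriv (D : IsTameComposition f φ Φ R M) (k : ℕ) (j : Fin 2) :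
    MemLp (fun x => fderiv ℝ (fun x => fderiv ℝ (compDeriv f φ k) x (planeBasis j)) x
      (planeBasis j)) 2 := by
  obtain ⟨B, hB⟩ := D.exists_fderiv_bound
  have h1 := D.tame.fderiv_apply (planeBasis j)
  have hG : MemLp (fun x => B * |fderiv ℝ φ x (planeBasis j)| +
      |fderiv ℝ (fun x => fderiv ℝ φ x (planeBasis j)) x (planeBasis j)|) 2 :=
    (h1.memLp_two.norm.const_mul B).add (h1.fderiv_apply _).memLp_two.norm
  refine hG.of_le_mul
    (continuous_fderiv_fderiv_compDeriv D.contDiff D.tame k _).aestronglyMeasurable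
    (c := M ^ (k + 3) * ((k + 2).factorial : ℝ)) (Filter.Eventually.of_forall fun x => ?_)
  have hB0 : 0 ≤ B := (abs_nonneg _).trans (hB 0 0)
  rw [Real.norm_of_nonneg (by positivity)]
  exact norm_fderiv_fderiv_compDeriv_le D.contDiff D.tame D.abs_lt D.one_le D.bound _ (hB j) k x

theorem isFourierPair_fderiv (D : IsTameComposition f φ Φ R M) {k : ℕ} {U : Plane → ℂ}
    (hp : IsFourierPair (compDeriv f φ k) U) (m : Plane) :
    IsFourierPair (fun x => fderiv ℝ (compDeriv f φ k) x m) (derivSymbol m U) :=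
  hp.fderiv (fun x => (hasFDerivAt_compDeriv D.contDiff D.tame k x).differentiableAt) m
    (D.memLp_compDeriv k).schwartzIntegrable (D.memLp_fderiv_compDeriv k m).schwartzIntegrable

theorem isFourierPair_subLaplacian (D : IsTameComposition f φ Φ R M) {k : ℕ} {U : Plane → ℂ}
    (hU : MemLp U 2) (hp : IsFourierPair (compDeriv f φ k) U) :
    IsFourierPair (compDerivSubLaplacian f φ k)
      (fun ζ => ((1 + 4 * Real.pi ^ 2 * ‖ζ‖ ^ 2 : ℝ) : ℂ) * U ζ) := by
  have hdd : ∀ j, IsFourierPair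
      (fun x => fderiv ℝ (fun x => fderiv ℝ (compDeriv f φ k) x (planeBasis j)) x (planeBasis j))
      (derivSymbol (planeBasis j) (derivSymbol (planeBasis j) U)) := fun j =>
    (D.isFourierPair_fderiv hp _).fderiv
      (fun x => (hasFDerivAt_fderiv_compDeriv D.contDiff D.tame k x _).differentiableAt) _
      (D.memLp_fderiv_compDeriv k _).schwartzIntegrable
      (D.memLp_fderiv_fderiv_compDeriv k j).schwartzIntegrable
  have hs1 : ∀ j, SchwartzIntegrable fun x => (-1 : ℂ) *
      fderiv ℝ (fun x => fderiv ℝ (compDeriv f φ k) x (planeBasis j)) x (planeBasis j) := fun j =>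
    ((D.memLp_fderiv_fderiv_compDeriv k j).const_mul (-1)).schwartzIntegrable
  have hs2 : ∀ j, SchwartzIntegrable fun ζ => (-1 : ℂ) *
      derivSymbol (planeBasis j) (derivSymbol (planeBasis j) U) ζ := fun j χ => by
    refine (((hU.schwartzIntegrable.derivSymbol (planeBasis j)).derivSymbol
      (planeBasis j) χ).const_mul (-1)).congr (Filter.Eventually.of_forall fun ζ => ?_)
    simp only
    ring
  have hsum := hp.add (((hdd 0).const_mul (-1)).add ((hdd 1).const_mul (-1)) (hs1 0) (hs1 1)
    (hs2 0) (hs2 1)) (D.memLp_compDeriv k).schwartzIntegrable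
    ((hs1 0).add (hs1 1)) hU.schwartzIntegrable ((hs2 0).add (hs2 1))
  refine hsum.congr (ae_eq_refl _) (Filter.Eventually.of_forall fun ζ => ?_)
  simp only [derivSymbol, inner_planeBasis, EuclideanSpace.real_norm_sq_eq, Fin.sum_univ_two]
  push_cast
  linear_combination (-4 * Real.pi ^ 2 * ((ζ 0 : ℝ) ^ 2 + (ζ 1 : ℝ) ^ 2) * U ζ : ℂ) *
    Complex.I_sq

/-- The two extra derivatives cost `(k + 1)(k + 2) ≤ 2·4ᵏ`, absorbed by enlarging the geometric
ratio. -/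
theorem bound_le_geometric (D : IsTameComposition f φ Φ R M) (k : ℕ) :
    M ^ (k + 3) * ((k + 2).factorial : ℝ) ≤ 2 * M ^ 3 * (4 * M) ^ k * k.factorial := by
  have hM0 : 0 ≤ M := zero_le_one.trans D.one_le
  have h1 : (k + 2).factorial ≤ 2 * 4 ^ k * k.factorial := by
    rw [Nat.factorial_succ, Nat.factorial_succ, ← mul_assoc, show 4 ^ k = 2 ^ k * 2 ^ k by
      rw [← mul_pow]; norm_num]
    have h := Nat.lt_two_pow_self (n := k)
    refine Nat.mul_le_mul_right _ ?_
    calc (k + 1 + 1) * (k + 1) ≤ (2 * 2 ^ k) * 2 ^ k := Nat.mul_le_mul (by omega) (by omega)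
      _ = _ := by ring
  have h2 : ((k + 2).factorial : ℝ) ≤ 2 * 4 ^ k * k.factorial := by exact_mod_cast h1
  calc _ ≤ M ^ (k + 3) * (2 * 4 ^ k * k.factorial) := by gcongr
    _ = _ := by ring

/-- The Fourier transforms of the functions `f⁽ᵏ⁾(φ) - f⁽ᵏ⁾(0)` are integrable, with norms
growing like those of the derivatives of an analytic function. -/
theorem exists_transforms (D : IsTameComposition f φ Φ R M) :
    ∃ (U : ℕ → Plane → ℂ) (C N : ℝ≥0∞), C ≠ ⊤ ∧ N ≠ ⊤ ∧ ∀ k,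
      Measurable (U k) ∧ MemLp (U k) 2 ∧ MemLp (derivSymbol (planeBasis 0) (U k)) 2 ∧
      IsFourierPair (compDeriv f φ k) (U k) ∧
      (∫⁻ ζ, ‖U k ζ‖ₑ) + ‖iteratedDeriv k f 0‖ₑ ≤ C * N ^ k * k.factorial := by
  have hM0 : 0 ≤ M := zero_le_one.trans D.one_le
  obtain ⟨B, hB⟩ := D.exists_fderiv_bound
  have hG := memLp_profileMajorant D.tame B
  set G := eLpNorm (profileMajorant φ B) 2 volume with hGdef
  -- The `+ 1` in the constant pays for `|f⁽ᵏ⁾(0)|`.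
  refine ⟨fun k => ⇑(𝓕 ((D.memLp_compDeriv k).toLp _) : L2C),
    (kernelNorm * G + 1) * ENNReal.ofReal (2 * M ^ 3), ENNReal.ofReal (4 * M),
    ENNReal.mul_ne_top (ENNReal.add_ne_top.2
      ⟨ENNReal.mul_ne_top kernelNorm_lt_top.ne hG.2.ne, ENNReal.one_ne_top⟩)
      ENNReal.ofReal_ne_top, ENNReal.ofReal_ne_top, fun k => ?_⟩
  set U : Plane → ℂ := ⇑(𝓕 ((D.memLp_compDeriv k).toLp _) : L2C) with hUdef
  have hU : MemLp U 2 := Lp.memLp _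
  have hUl : LocallyIntegrable U := hU.locallyIntegrable (by norm_num)
  have hp : IsFourierPair (compDeriv f φ k) U :=
    (MemLp.isFourierPair ((D.memLp_compDeriv k).toLp _)).congr
      (D.memLp_compDeriv k).coeFn_toLp (ae_eq_refl _)
  have hv : MemLp (compDerivSubLaplacian f φ k) 2 :=
    (D.memLp_compDeriv k).add (((D.memLp_fderiv_fderiv_compDeriv k 0).const_mul (-1)).add
      ((D.memLp_fderiv_fderiv_compDeriv k 1).const_mul (-1)))
  have hV := (D.isFourierPair_subLaplacian hU hp).memLp_right hv
    (hUl.continuous_mul (by fun_prop))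
  refine ⟨(Lp.stronglyMeasurable _).measurable, hU,
    ((D.isFourierPair_fderiv hp _).memLp_right (D.memLp_fderiv_compDeriv k _)
      (locallyIntegrable_derivSymbol hUl _)).1, hp, ?_⟩
  have hle : ENNReal.ofReal (M ^ (k + 3) * ((k + 2).factorial : ℝ)) ≤
      ENNReal.ofReal (2 * M ^ 3) * ENNReal.ofReal (4 * M) ^ k * k.factorial := by
    rw [← ENNReal.ofReal_pow (by positivity), ← ENNReal.ofReal_natCast k.factorial,
      ← ENNReal.ofReal_mul (by positivity), ← ENNReal.ofReal_mul (by positivity)]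
    exact ENNReal.ofReal_le_ofReal (D.bound_le_geometric k)
  have h1 : ∫⁻ ζ, ‖U ζ‖ₑ ≤ kernelNorm *
      (ENNReal.ofReal (M ^ (k + 3) * ((k + 2).factorial : ℝ)) * G) := by
    refine (lintegral_enorm_le_kernelNorm_mul hV.1.1 fun ζ => ?_).trans ?_
    · rw [norm_mul, Complex.norm_real, Real.norm_of_nonneg (by positivity)]
      have : (1 : ℝ) ≤ 4 * Real.pi ^ 2 := by nlinarith [Real.two_le_pi]
      gcongr
      exact le_mul_of_one_le_left (by positivity) this
    · rw [hV.2]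
      gcongr
      refine eLpNorm_le_mul_eLpNorm_of_ae_le_mul (Filter.Eventually.of_forall fun x => ?_) 2
      refine (norm_compDerivSubLaplacian_le D.contDiff D.tame D.abs_lt D.one_le D.bound hB k
        x).trans ?_
      gcongr
      exact le_abs_self _
  have h2 : ‖iteratedDeriv k f 0‖ₑ ≤ ENNReal.ofReal (M ^ (k + 3) * ((k + 2).factorial : ℝ)) := by
    rw [← ofReal_norm]
    exact ENNReal.ofReal_le_ofReal ((D.bound_zero k).trans
      (pow_mul_factorial_mono D.one_le (by omega)))
  calc _ ≤ (kernelNorm * G + 1) * ENNReal.ofReal (M ^ (k + 3) * ((k + 2).factorial : ℝ)) :=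
        (add_le_add h1 h2).trans (le_of_eq (by ring))
    _ ≤ (kernelNorm * G + 1) *
        (ENNReal.ofReal (2 * M ^ 3) * ENNReal.ofReal (4 * M) ^ k * k.factorial) := by gcongr
    _ = _ := by ring

/-- The chain rule `∂ₘ (f⁽ᵏ⁾(φ)) = f⁽ᵏ⁺¹⁾(φ) ∂ₘ φ` on the Fourier side. -/
theorem derivSymbol_ae_eq (D : IsTameComposition f φ Φ R M) {k : ℕ} {U V : Plane → ℂ}
    (hU : LocallyIntegrable U) (hp : IsFourierPair (compDeriv f φ k) U)
    (hV : Integrable V) (hp' : IsFourierPair (compDeriv f φ (k + 1)) V) (m : Plane) :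
    derivSymbol m U =ᵐ[volume] fun ζ => ((iteratedDeriv (k + 1) f 0 : ℝ) : ℂ) * derivSymbol m Φ ζ +
      convolution (derivSymbol m Φ) V (ContinuousLinearMap.mul ℂ ℂ) volume ζ := by
  have hΦ : Integrable (derivSymbol m Φ) := (D.tame.toHasMoments.derivSymbol m).integrable
  have hcont := continuous_compDeriv D.contDiff D.tame (k + 1)
  -- Both sides are continuous, so equality almost everywhere is equality.
  have hV' : compDeriv f φ (k + 1) = 𝓕⁻ V :=
    (hcont.ae_eq_iff_eq volume (continuous_fourierInv hV)).1
      (hp'.ae_eq_left (isFourierPair_fourierInv hV) hcont.locallyIntegrable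
        (continuous_fourierInv hV).locallyIntegrable)
  have hconv : Integrable (convolution (derivSymbol m Φ) V (ContinuousLinearMap.mul ℂ ℂ)
      volume) := hΦ.integrable_convolution _ hV
  have hd : Integrable fun ζ => ((iteratedDeriv (k + 1) f 0 : ℝ) : ℂ) * derivSymbol m Φ ζ :=
    hΦ.const_mul _
  have hbdd : ∀ {W : Plane → ℂ}, Integrable W → SchwartzIntegrable (𝓕⁻ W) := fun hW =>
    schwartzIntegrable_of_bounded (continuous_fourierInv hW).aestronglyMeasurable
      (norm_fourierInv_le _)
  -- The constant part of `f⁽ᵏ⁺¹⁾(φ)` has a Dirac mass as transform, so it enters as a separate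
  -- multiple of `∂ₘφ` and only the rest as a convolution.
  have hpair := ((isFourierPair_fourierInv hΦ).const_mul ((iteratedDeriv (k + 1) f 0 : ℝ) : ℂ)).add
    (isFourierPair_fourierInv hconv)
    (schwartzIntegrable_of_bounded
      (continuous_const.mul (continuous_fourierInv hΦ)).aestronglyMeasurable
      (A := ‖((iteratedDeriv (k + 1) f 0 : ℝ) : ℂ)‖ * ∫ ζ, ‖derivSymbol m Φ ζ‖) fun x => by
        rw [norm_mul]
        gcongr
        exact norm_fourierInv_le _ _)
    (hbdd hconv) hd.schwartzIntegrable hconv.schwartzIntegrable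
  refine (D.isFourierPair_fderiv hp m).ae_eq_right (hpair.congr
    (Filter.Eventually.of_forall fun x => ?_) (ae_eq_refl _))
    (locallyIntegrable_derivSymbol hU m) (hd.add hconv).locallyIntegrable
  simp only
  rw [fourierInv_convolution hΦ hV, ← hV', ← (D.tame.fderiv_apply m).ofReal_eq,
    fderiv_compDeriv D.contDiff D.tame, compDeriv]
  push_cast
  ring

end IsTameComposition

end Transforms

/-! ### The recursion for weighted `L¹` moments. -/

section WeightedBounds

/-- The subadditive weight `|ξ| + |η|` on the frequency plane. -/
noncomputable def planeWeight (ζ : Plane) : ℝ≥0∞ := ‖ζ 0‖ₑ + ‖ζ 1‖ₑ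

theorem measurable_planeWeight : Measurable planeWeight := by
  unfold planeWeight
  fun_prop

theorem planeWeight_add_le (ζ τ : Plane) :
    planeWeight (ζ + τ) ≤ planeWeight ζ + planeWeight τ := by
  calc planeWeight (ζ + τ) ≤ (‖ζ 0‖ₑ + ‖τ 0‖ₑ) + (‖ζ 1‖ₑ + ‖τ 1‖ₑ) :=
        add_le_add (enorm_add_le _ _) (enorm_add_le _ _)
    _ = _ := by simp only [planeWeight]; ring

theorem enorm_derivSymbol_planeBasis (j : Fin 2) (U : Plane → ℂ) (ζ : Plane) :
    ‖derivSymbol (planeBasis j) U ζ‖ₑ = ENNReal.ofReal (2 * Real.pi) * (‖ζ j‖ₑ * ‖U ζ‖ₑ) := by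
  rw [← ofReal_norm, norm_derivSymbol, inner_planeBasis, mul_assoc,
    ENNReal.ofReal_mul (by positivity), ENNReal.ofReal_mul (abs_nonneg _), ← Real.norm_eq_abs,
    ofReal_norm, ofReal_norm]

namespace IsTameComposition

variable {f : ℝ → ℝ} {φ : Plane → ℝ} {Φ : Plane → ℂ} {R M : ℝ}

/-- Absolute values in the chain rule for each coordinate direction, with `2π` cancelled; the two
estimates add up because the weight is a sum over coordinates. -/
theorem planeWeight_mul_le (D : IsTameComposition f φ Φ R M) {k : ℕ} {U V : Plane → ℂ}
    (hΦ : Measurable Φ) (hVm : Measurable V)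
    (hU : LocallyIntegrable U) (hp : IsFourierPair (compDeriv f φ k) U)
    (hV : Integrable V) (hp' : IsFourierPair (compDeriv f φ (k + 1)) V) :
    ∀ᵐ ζ, planeWeight ζ * ‖U ζ‖ₑ ≤
      ‖iteratedDeriv (k + 1) f 0‖ₑ * (planeWeight ζ * ‖Φ ζ‖ₑ) +
        ∫⁻ τ, ‖V (ζ - τ)‖ₑ * (planeWeight τ * ‖Φ τ‖ₑ) := by
  have hpi : ENNReal.ofReal (2 * Real.pi) ≠ 0 := by simp [Real.pi_pos]
  have key : ∀ j : Fin 2, ∀ᵐ ζ, ‖ζ j‖ₑ * ‖U ζ‖ₑ ≤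
      ‖iteratedDeriv (k + 1) f 0‖ₑ * (‖ζ j‖ₑ * ‖Φ ζ‖ₑ) +
        ∫⁻ τ, ‖V (ζ - τ)‖ₑ * (‖τ j‖ₑ * ‖Φ τ‖ₑ) := by
    intro j
    filter_upwards [D.derivSymbol_ae_eq hU hp hV hp' (planeBasis j)] with ζ hζ
    have h1 := congrArg (‖·‖ₑ) hζ
    simp only [enorm_derivSymbol_planeBasis] at h1
    rw [← ENNReal.mul_le_mul_iff_right hpi ENNReal.ofReal_ne_top, h1]
    refine (enorm_add_le _ _).trans ?_
    rw [mul_add]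
    refine add_le_add (le_of_eq ?_) ?_
    · rw [enorm_mul, enorm_derivSymbol_planeBasis, ← ofReal_norm, Complex.norm_real, ofReal_norm]
      ring
    · rw [convolution_def]
      refine (enorm_integral_le_lintegral_enorm _).trans (le_of_eq ?_)
      rw [← lintegral_const_mul']
      · refine lintegral_congr fun τ => ?_
        rw [ContinuousLinearMap.mul_apply', enorm_mul, enorm_derivSymbol_planeBasis]
        ring
      · exact ENNReal.ofReal_ne_top
  filter_upwards [key 0, key 1] with ζ h0 h1
  have hm : ∀ j : Fin 2, Measurable fun τ => ‖V (ζ - τ)‖ₑ * (‖τ j‖ₑ * ‖Φ τ‖ₑ) := fun j =>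
    ((hVm.comp (measurable_const.sub measurable_id)).enorm).mul
      ((by fun_prop : Measurable fun τ : Plane => ‖τ j‖ₑ).mul hΦ.enorm)
  simp only [planeWeight, add_mul, mul_add]
  rw [lintegral_add_left (hm 0)]
  exact (add_le_add h0 h1).trans (le_of_eq (by ring))

/-- `heq` bounds the moments of `w|Φ|` by those of `U 0`, which closes the chain-rule inequalities
into the binomial recursion. -/
theorem lintegral_planeWeight_pow_le (D : IsTameComposition f φ Φ R M) {U : ℕ → Plane → ℂ}
    {C N : ℝ≥0∞} (hC : C ≠ ⊤) (hN : N ≠ ⊤) (hΦ : Measurable Φ) (hU : ∀ k, Measurable (U k))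
    (hU2 : ∀ k, MemLp (U k) 2) (hp : ∀ k, IsFourierPair (compDeriv f φ k) (U k))
    (hb : ∀ k, (∫⁻ ζ, ‖U k ζ‖ₑ) + ‖iteratedDeriv k f 0‖ₑ ≤ C * N ^ k * k.factorial)
    (heq : ∀ᵐ ζ, planeWeight ζ * ‖Φ ζ‖ₑ ≤ ‖U 0 ζ‖ₑ) (n : ℕ) :
    ∫⁻ ζ, planeWeight ζ ^ (n + 1) * ‖Φ ζ‖ₑ ≤ C * (2 * N * C) ^ n * n.factorial := by
  have hi : ∀ k, Integrable (U k) := fun k => ⟨(hU k).aestronglyMeasurable, by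
    refine lt_of_le_of_lt (le_self_add.trans (hb k)) ?_
    exact (ENNReal.mul_ne_top (ENNReal.mul_ne_top hC (ENNReal.pow_ne_top hN))
      (ENNReal.natCast_ne_top _)).lt_top⟩
  have hw := measurable_planeWeight
  let A : ℕ → ℕ → ℝ≥0∞ := fun k n => ∫⁻ ζ, planeWeight ζ ^ n * ‖U k ζ‖ₑ
  let a : ℕ → ℝ≥0∞ := fun n => ∫⁻ ζ, planeWeight ζ ^ n * (planeWeight ζ * ‖Φ ζ‖ₑ)
  -- The correction is the Dirac mass of the constant `f⁽ᵏ⁾(0)`: the weight vanishes at the origin,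
  -- so only the moment `n = 0` sees it.
  let b : ℕ → ℕ → ℝ≥0∞ := fun k n => A k n + if n = 0 then ‖iteratedDeriv k f 0‖ₑ else 0
  have ha : ∀ n, a n ≤ b 0 n := fun n => by
    refine le_trans (lintegral_mono_ae ?_) le_self_add
    filter_upwards [heq] with ζ hζ
    gcongr
  have hA : ∀ k n, A k (n + 1) ≤ ‖iteratedDeriv (k + 1) f 0‖ₑ * a n +
      ∑ p ∈ Finset.HasAntidiagonal.antidiagonal n,
        (n.choose p.1 : ℝ≥0∞) * (A (k + 1) p.1 * a p.2) := by
    intro k n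
    have h1 := lintegral_pow_mul_convolution_le (μ := (volume : Measure Plane)) hw
      planeWeight_add_le (hU (k + 1)).enorm (hw.mul hΦ.enorm) n
    refine le_trans ?_ (add_le_add le_rfl h1)
    have hae := D.planeWeight_mul_le hΦ (hU (k + 1)) ((hU2 k).locallyIntegrable (by norm_num))
      (hp k) (hi (k + 1)) (hp (k + 1))
    simp only [a]
    rw [← lintegral_const_mul' _ _ enorm_ne_top, ← lintegral_add_left (by fun_prop)]
    refine lintegral_mono_ae ?_
    filter_upwards [hae] with ζ hζ
    calc planeWeight ζ ^ (n + 1) * ‖U k ζ‖ₑ = planeWeight ζ ^ n * (planeWeight ζ * ‖U k ζ‖ₑ) := by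
          ring
      _ ≤ planeWeight ζ ^ n * (‖iteratedDeriv (k + 1) f 0‖ₑ * (planeWeight ζ * ‖Φ ζ‖ₑ) +
          ∫⁻ τ, ‖U (k + 1) (ζ - τ)‖ₑ * (planeWeight τ * ‖Φ τ‖ₑ)) := by gcongr
      _ = _ := by
          simp only [Pi.mul_apply]
          ring
  have hrec : ∀ k n, b k (n + 1) ≤ ∑ p ∈ Finset.HasAntidiagonal.antidiagonal n,
      (n.choose p.1 : ℝ≥0∞) * (b (k + 1) p.1 * b 0 p.2) := by
    intro k n
    calc b k (n + 1) = A k (n + 1) := by simp [b]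
      _ ≤ _ := hA k n
      _ = ∑ p ∈ Finset.HasAntidiagonal.antidiagonal n,
          (n.choose p.1 : ℝ≥0∞) * (b (k + 1) p.1 * a p.2) := by
          simp only [b, add_mul, mul_add, Finset.sum_add_distrib]
          rw [add_comm]
          congr 1
          -- Only the pair `(0, n)` carries the correction, and it reproduces the term `|f⁽ᵏ⁺¹⁾(0)|
          -- a n`.
          rw [Finset.sum_eq_single_of_mem (0, n) (by simp)]
          · simp
          · intro p hp h0
            have : p.1 ≠ 0 := fun h => h0 (Prod.ext h (by
              rw [Finset.HasAntidiagonal.mem_antidiagonal, h, zero_add] at hp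
              exact hp))
            simp [this]
      _ ≤ _ := by
          gcongr
          exact ha _
  have hfin := le_of_binomial_recursion (b := b) (C := C) (M := N)
    (fun k => by simpa [b, A] using hb k) hrec n 0
  calc _ = a n := by
        refine lintegral_congr fun ζ => ?_
        rw [pow_succ, mul_assoc]
    _ ≤ _ := (ha n).trans hfin
    _ ≤ C * (N * C) ^ n * ((2 ^ n * n.factorial : ℕ) : ℝ≥0∞) := by
        simp only [pow_zero, mul_one, Nat.factorial_zero, Nat.cast_one, zero_add]
        gcongr
        exact stepTwoFactorial_one_le n
    _ = _ := by
        push_cast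
        ring

end IsTameComposition

end WeightedBounds

/-! ### Sobolev regularity and test functions on the Fourier side. -/

section Equation

/-- The Sobolev order `s = 2n` makes the Bessel weight `(1 + |ζ|²)^(s/2)` a polynomial. -/
theorem memLp_one_add_norm_sq_pow_mul {v : L2C}
    (h : ∀ s : ℝ, TemperedDistribution.MemSobolev s 2 (v : 𝓢'(Plane, ℂ))) (n : ℕ) :
    MemLp (fun ζ => (((1 + ‖ζ‖ ^ 2) ^ n : ℝ) : ℂ) * (𝓕 v : L2C) ζ) 2 := by
  obtain ⟨g, hg⟩ := TemperedDistribution.memSobolev_iff_exists_smulLeftCLM_fourier.1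
    (h (2 * n))
  have hpow : (fun ζ : Plane => (((1 + ‖ζ‖ ^ 2) ^ ((2 * n : ℝ) / 2) : ℝ) : ℂ)) =
      fun ζ => (((1 + ‖ζ‖ ^ 2) ^ n : ℝ) : ℂ) := by
    ext ζ
    rw [mul_div_cancel_left₀ _ two_ne_zero, Real.rpow_natCast]
  have ht : (fun ζ : Plane => (((1 + ‖ζ‖ ^ 2) ^ n : ℝ) : ℂ)).HasTemperateGrowth := by
    rw [← hpow]
    fun_prop
  rw [hpow, Lp.fourier_toTemperedDistribution_eq] at hg
  refine (memLp_congr_ae ?_).2 (Lp.memLp g)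
  refine ae_eq_of_integral_contDiff_smul_eq
    (LocallyIntegrable.continuous_mul (by fun_prop)
      ((Lp.memLp _).locallyIntegrable (by norm_num)))
    ((Lp.memLp _).locallyIntegrable (by norm_num)) fun ψ hψ hψc => ?_
  have h1 : HasCompactSupport (Complex.ofRealCLM ∘ ψ) := hψc.comp_left rfl
  have h2 : ContDiff ℝ ∞ (Complex.ofRealCLM ∘ ψ) := by fun_prop
  have h3 := DFunLike.congr_fun hg (h1.toSchwartzMap h2)
  rw [TemperedDistribution.smulLeftCLM_apply_apply, Lp.toTemperedDistribution_apply,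
    Lp.toTemperedDistribution_apply] at h3
  refine Eq.trans ?_ (h3.trans ?_)
  swap
  · exact integral_congr_ae (Filter.Eventually.of_forall fun ζ => by simp)
  refine integral_congr_ae (Filter.Eventually.of_forall fun ζ => ?_)
  simp only [SchwartzMap.smulLeftCLM_apply_apply ht]
  simp
  ring

/-- The `L¹` moments use one more factor `1 + |ζ|²` than the `L²` ones, spent in Cauchy–Schwarz. -/
theorem hasSquareMoments_fourier {v : L2C}
    (h : ∀ s : ℝ, TemperedDistribution.MemSobolev s 2 (v : 𝓢'(Plane, ℂ))) :
    HasSquareMoments (𝓕 v : L2C) := by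
  have hm : AEStronglyMeasurable (𝓕 v : L2C) (volume : Measure Plane) :=
    Lp.aestronglyMeasurable _
  have hle : ∀ (n : ℕ) (ζ : Plane), ‖ζ‖ ^ n ≤ (1 + ‖ζ‖ ^ 2) ^ n := fun n ζ => by
    gcongr
    nlinarith [sq_nonneg (‖ζ‖ - 1), norm_nonneg ζ]
  have hms : ∀ n : ℕ, AEStronglyMeasurable (fun ζ : Plane => ‖ζ‖ ^ n * ‖(𝓕 v : L2C) ζ‖) :=
    fun n => (by fun_prop : Continuous fun ζ : Plane => ‖ζ‖ ^ n).aestronglyMeasurable.mul hm.norm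
  refine ⟨⟨hm, fun n => ⟨hms n, ?_⟩⟩, fun n => ?_⟩
  · have hV := memLp_one_add_norm_sq_pow_mul h (n + 1)
    refine lt_of_le_of_lt (lintegral_enorm_le_kernelNorm_mul hV.1 fun ζ => ?_)
      (ENNReal.mul_lt_top kernelNorm_lt_top hV.2)
    rw [Real.norm_of_nonneg (by positivity), norm_mul, Complex.norm_real,
      Real.norm_of_nonneg (by positivity), pow_succ' _ n, mul_assoc]
    exact mul_le_mul_of_nonneg_left (mul_le_mul_of_nonneg_right (hle n ζ) (norm_nonneg _))
      (by positivity)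
  · refine (memLp_one_add_norm_sq_pow_mul h n).mono (hms n)
      (Filter.Eventually.of_forall fun ζ => ?_)
    rw [Real.norm_of_nonneg (by positivity), norm_mul, Complex.norm_real,
      Real.norm_of_nonneg (by positivity)]
    exact mul_le_mul_of_nonneg_right (hle n ζ) (norm_nonneg _)

open scoped LineDeriv in
theorem exists_fourier_eq_laplacian (χ : 𝓢(Plane, ℂ)) :
    ∃ χ' : 𝓢(Plane, ℂ), (∀ ζ, χ' ζ = -((4 * Real.pi ^ 2 * ‖ζ‖ ^ 2 : ℝ) : ℂ) * χ ζ) ∧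
      𝓕 χ' = Δ (𝓕 χ : 𝓢(Plane, ℂ)) := by
  have key : ∀ (m : Plane) (χ : 𝓢(Plane, ℂ)), ∃ χ' : 𝓢(Plane, ℂ),
      (∀ ζ, χ' ζ = -derivSymbol m χ ζ) ∧ 𝓕 χ' = ∂_{m} (𝓕 χ : 𝓢(Plane, ℂ)) := fun m χ => by
    obtain ⟨χ', h1, h2⟩ := fourier_derivSymbol m χ
    refine ⟨χ', h1, ?_⟩
    ext x
    rw [h2, SchwartzMap.lineDerivOp_apply_eq_fderiv]
  have key2 : ∀ m : Plane, ∃ χ' : 𝓢(Plane, ℂ),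
      (∀ ζ, χ' ζ = derivSymbol m (derivSymbol m χ) ζ) ∧
        𝓕 χ' = ∂_{m} (∂_{m} (𝓕 χ : 𝓢(Plane, ℂ))) := fun m => by
    obtain ⟨χ1, h1, h2⟩ := key m χ
    obtain ⟨χ2, h3, h4⟩ := key m χ1
    refine ⟨χ2, fun ζ => ?_, by rw [h4, h2]⟩
    rw [h3]
    simp only [derivSymbol, h1]
    ring
  choose X hX1 hX2 using fun j : Fin 2 => key2 (planeBasis j)
  refine ⟨X 0 + X 1, fun ζ => ?_, ?_⟩
  · simp only [add_apply, hX1, derivSymbol, inner_planeBasis,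
      EuclideanSpace.real_norm_sq_eq, Fin.sum_univ_two]
    push_cast
    linear_combination (4 * Real.pi ^ 2 * ((ζ 0 : ℝ) ^ 2 + (ζ 1 : ℝ) ^ 2) * χ ζ : ℂ) *
      Complex.I_sq
  · rw [SchwartzMap.laplacian_eq_sum (EuclideanSpace.basisFun (Fin 2) ℝ), Fin.sum_univ_two,
      FourierTransform.fourier_add, hX2, hX2]
    simp [planeBasis]

theorem isFourierPair_hilbertX (v : L2C) :
    IsFourierPair (hilbertX v) (fun ζ => symbolHilbert ζ * (𝓕 v : L2C) ζ) := by
  refine (MemLp.isFourierPair (hilbertX v)).congr (ae_eq_refl _) ?_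
  rw [hilbertX, FourierTransform.fourier_fourierInv_eq]
  exact MemLp.coeFn_toLp _

/-- The equation is available only for real compactly supported `ψ`; these already force the inverse
transform of `T` to vanish. -/
theorem ae_eq_zero_of_isFourierPair {T : Plane → ℂ} (hT : MemLp T 2)
    (h : ∀ (ψ : Plane → ℝ), ContDiff ℝ ∞ ψ → HasCompactSupport ψ → ∀ χ : 𝓢(Plane, ℂ),
      (∀ x, (𝓕 χ) x = (ψ x : ℂ)) → ∫ ζ, χ ζ * T ζ = 0) : T =ᵐ[volume] 0 := by
  have hp : IsFourierPair (𝓕⁻ (hT.toLp T) : L2C) T := by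
    refine (MemLp.isFourierPair (𝓕⁻ (hT.toLp T))).congr (ae_eq_refl _) ?_
    rw [FourierTransform.fourier_fourierInv_eq]
    exact hT.coeFn_toLp
  have hW : ((𝓕⁻ (hT.toLp T) : L2C) : Plane → ℂ) =ᵐ[volume] 0 := by
    refine ae_eq_zero_of_integral_contDiff_smul_eq_zero
      ((Lp.memLp _).locallyIntegrable (by norm_num)) fun ψ hψ hψc => ?_
    have h1 : HasCompactSupport (Complex.ofRealCLM ∘ ψ) := hψc.comp_left rfl
    have h2 : ContDiff ℝ ∞ (Complex.ofRealCLM ∘ ψ) := by fun_prop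
    have h3 : ∀ x, (𝓕 (𝓕⁻ (h1.toSchwartzMap h2))) x = (ψ x : ℂ) := fun x => by simp
    have h4 := (hp _).trans (h ψ hψ hψc _ h3)
    simpa only [h3, Complex.real_smul] using h4
  have hz : IsFourierPair (𝓕⁻ (hT.toLp T) : L2C) 0 := by
    intro χ
    have : ∫ x, (𝓕 χ) x * (𝓕⁻ (hT.toLp T) : L2C) x = ∫ x : Plane, (0 : ℂ) :=
      integral_congr_ae (hW.mono fun x hx => by simp [hx])
    rw [this]
    simp
  exact hp.ae_eq_right hz (hT.locallyIntegrable (by norm_num)) (locallyIntegrable_zero)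

/-- Allows `f(φ)`, which need not be in `L²`, to be replaced by `f(φ) - f(0)` in the equation. -/
theorem integral_partialX_eq_zero {ψ : Plane → ℝ} (hψ : ContDiff ℝ ∞ ψ)
    (hc : HasCompactSupport ψ) : ∫ p, partialX ψ p = 0 := by
  have hd : Continuous fun p => partialX ψ p :=
    (hψ.continuous_fderiv (by simp)).clm_apply continuous_const
  have hi : Integrable fun p => partialX ψ p :=
    hd.integrable_of_hasCompactSupport (hc.fderiv_apply ℝ _)
  have h := integral_mul_fderiv_eq_neg_fderiv_mul_of_integrable (μ := (volume : Measure Plane))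
    (f := fun _ : Plane => (1 : ℝ)) (g := ψ) (v := EuclideanSpace.single 0 1) (by simp)
    (by simpa [partialX] using hi) (by simpa using hψ.continuous.integrable_of_hasCompactSupport hc)
    (fun _ _ => differentiableAt_const _) (fun x _ => hψ.differentiable (by simp) x)
  simpa [partialX] using h

end Equation

/-! ### The equation in frequency space, its elliptic gain, and the conclusion. -/

section SolitaryWave

theorem toL2C_ae_eq (u : L2R) : (toL2C u : Plane → ℂ) =ᵐ[volume] fun p => ((u p : ℝ) : ℂ) :=
  Complex.ofRealCLM.coeFn_compLp u

/-- Fourier inversion supplies a continuous representative; it is real because it agrees almost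
everywhere with its real part. -/
theorem exists_isTameProfile {u : L2R} (hH : MemHInfty u) :
    ∃ φ : Plane → ℝ, IsTameProfile φ (𝓕 (toL2C u) : L2C) ∧ (u : Plane → ℝ) =ᵐ[volume] φ := by
  have hΦ := hasSquareMoments_fourier hH
  have hc := continuous_fourierInv hΦ.integrable
  have h1 : (toL2C u : Plane → ℂ) =ᵐ[volume] 𝓕⁻ ((𝓕 (toL2C u) : L2C) : Plane → ℂ) :=
    (MemLp.isFourierPair (toL2C u)).ae_eq_left (isFourierPair_fourierInv hΦ.integrable)
      ((Lp.memLp _).locallyIntegrable (by norm_num)) hc.locallyIntegrable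
  have h2 : (u : Plane → ℝ) =ᵐ[volume]
      fun p => (𝓕⁻ ((𝓕 (toL2C u) : L2C) : Plane → ℂ) p).re := by
    filter_upwards [h1, toL2C_ae_eq u] with p hp hp'
    rw [← hp, hp', Complex.ofReal_re]
  refine ⟨_, ⟨hΦ, fun x => ?_⟩, h2⟩
  have h3 : (fun p => (((𝓕⁻ ((𝓕 (toL2C u) : L2C) : Plane → ℂ) p).re : ℝ) : ℂ)) =ᵐ[volume]
      𝓕⁻ ((𝓕 (toL2C u) : L2C) : Plane → ℂ) := by
    filter_upwards [h1, h2, toL2C_ae_eq u] with p hp hp' hp''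
    rw [← hp', ← hp, hp'']
  exact congrFun (((Complex.continuous_ofReal.comp (Complex.continuous_re.comp hc)).ae_eq_iff_eq
    volume hc).1 h3) x

/-- The difference of the two sides of the equation on the Fourier side. -/
noncomputable def fourierResidual (c : ℝ) (Φ U : Plane → ℂ) (ζ : Plane) : ℂ :=
  -(c : ℂ) * derivSymbol (planeBasis 0) Φ ζ +
    (((4 * Real.pi ^ 2 * ‖ζ‖ ^ 2 : ℝ) : ℂ) * (symbolHilbert ζ * Φ ζ) +
      derivSymbol (planeBasis 0) U ζ)

/-- Writing `ψ = 𝓕 χ` moves each of the three integrals in the weak equation to the Fourier side,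
where derivatives of `ψ` become polynomial multiples of `χ`. -/
theorem fourierResidual_ae_eq_zero {f : ℝ → ℝ} {c R M : ℝ} {u : L2R} {φ : Plane → ℝ}
    (D : IsTameComposition f φ (𝓕 (toL2C u) : L2C) R M) (hu : (u : Plane → ℝ) =ᵐ[volume] φ)
    {U : Plane → ℂ}
    (hdU : MemLp (derivSymbol (planeBasis 0) U) 2) (hp : IsFourierPair (compDeriv f φ 0) U)
    (hw : IsSolitaryWave f c u) :
    fourierResidual c (𝓕 (toL2C u) : L2C) U =ᵐ[volume] 0 := by
  set Φ : Plane → ℂ := ⇑(𝓕 (toL2C u) : L2C) with hΦdef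
  have hΦ : HasSquareMoments Φ := D.tame.toHasSquareMoments
  have hm1 : MemLp (fun ζ => -(c : ℂ) * derivSymbol (planeBasis 0) Φ ζ) 2 :=
    (hΦ.derivSymbol _).memLp.const_mul _
  have hm2 : MemLp (fun ζ => ((4 * Real.pi ^ 2 * ‖ζ‖ ^ 2 : ℝ) : ℂ) * (symbolHilbert ζ * Φ ζ))
      2 := by
    refine ((hΦ.memLp_pow 2).const_mul (4 * Real.pi ^ 2)).mono
      ((by fun_prop : Continuous fun ζ : Plane =>
        ((4 * Real.pi ^ 2 * ‖ζ‖ ^ 2 : ℝ) : ℂ)).aestronglyMeasurable.mul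
        (measurable_symbolHilbert.aestronglyMeasurable.mul hΦ.aestronglyMeasurable))
      (Filter.Eventually.of_forall fun ζ => ?_)
    rw [norm_mul, norm_mul, Complex.norm_real, Real.norm_of_nonneg (by positivity),
      Real.norm_of_nonneg (by positivity), mul_assoc (4 * Real.pi ^ 2)]
    gcongr
    exact mul_le_of_le_one_left (norm_nonneg _) (norm_symbolHilbert_le ζ)
  refine ae_eq_zero_of_isFourierPair (hm1.add (hm2.add hdU)) fun ψ hψ hψc χ hχ => ?_
  have hfun : ⇑(𝓕 χ : 𝓢(Plane, ℂ)) = Complex.ofRealCLM ∘ ψ := funext fun p => hχ p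
  have hdψ : ∀ p, fderiv ℝ (𝓕 χ : 𝓢(Plane, ℂ)) p (planeBasis 0) = (partialX ψ p : ℂ) := by
    intro p
    rw [hfun, (Complex.ofRealCLM.hasFDerivAt.comp p
      (hψ.differentiable (by simp) p).hasFDerivAt).fderiv]
    rfl
  have hΔψ : ∀ p, (Δ (𝓕 χ : 𝓢(Plane, ℂ)) : 𝓢(Plane, ℂ)) p = ((Δ ψ p : ℝ) : ℂ) := by
    intro p
    rw [SchwartzMap.laplacian_apply, hfun,
      ((hψ.of_le (by norm_cast)).contDiffAt).laplacian_CLM_comp_left]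
    rfl
  obtain ⟨χ1, h1, h1'⟩ := fourier_derivSymbol (planeBasis 0) χ
  obtain ⟨χ2, h2, h2'⟩ := exists_fourier_eq_laplacian χ
  have hφ1 : ((∫ p, u p * partialX ψ p : ℝ) : ℂ) =
      -∫ ζ, χ ζ * derivSymbol (planeBasis 0) Φ ζ := by
    rw [← integral_complex_ofReal, ← integral_neg]
    refine Eq.trans ?_ (((MemLp.isFourierPair (toL2C u)) χ1).trans ?_)
    · refine integral_congr_ae ?_
      filter_upwards [toL2C_ae_eq u] with p hp
      rw [h1', hdψ, hp]
      push_cast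
      ring
    · refine integral_congr_ae (Filter.Eventually.of_forall fun ζ => ?_)
      simp only [h1, derivSymbol, hΦdef]
      ring
  have hφ2 : ∫ p, hilbertX (toL2C u) p * ((Δ ψ p : ℝ) : ℂ) =
      -∫ ζ, χ ζ * (((4 * Real.pi ^ 2 * ‖ζ‖ ^ 2 : ℝ) : ℂ) * (symbolHilbert ζ * Φ ζ)) := by
    rw [← integral_neg]
    refine Eq.trans ?_ ((isFourierPair_hilbertX (toL2C u) χ2).trans ?_)
    · refine integral_congr_ae (Filter.Eventually.of_forall fun p => ?_)
      simp only [h2', hΔψ]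
      ring
    · refine integral_congr_ae (Filter.Eventually.of_forall fun ζ => ?_)
      simp only [h2, hΦdef]
      ring
  have hφ3 : ((∫ p, f (u p) * partialX ψ p : ℝ) : ℂ) =
      -∫ ζ, χ ζ * derivSymbol (planeBasis 0) U ζ := by
    have hd : Continuous fun p => partialX ψ p :=
      (hψ.continuous_fderiv (by simp)).clm_apply continuous_const
    have hcs : HasCompactSupport fun p => partialX ψ p := hψc.fderiv_apply ℝ _
    have hs : ∫ p, f (u p) * partialX ψ p = ∫ p, (f (φ p) - f 0) * partialX ψ p := by
      have hfc : Continuous fun p => f (φ p) :=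
        D.contDiff.continuous.comp D.tame.contDiff.continuous
      calc _ = ∫ p, ((f (φ p) - f 0) * partialX ψ p + f 0 * partialX ψ p) := by
            refine integral_congr_ae ?_
            filter_upwards [hu] with p hp
            rw [hp]
            ring
        _ = _ := by
            rw [integral_add, integral_const_mul, integral_partialX_eq_zero hψ hψc, mul_zero,
              add_zero]
            · exact ((hfc.sub continuous_const).mul hd).integrable_of_hasCompactSupport
                hcs.mul_left
            · exact (hd.integrable_of_hasCompactSupport hcs).const_mul _
    rw [hs, ← integral_complex_ofReal, ← integral_neg]
    refine Eq.trans ?_ ((hp χ1).trans ?_)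
    · refine integral_congr_ae (Filter.Eventually.of_forall fun p => ?_)
      simp only [h1', hdψ, compDeriv, iteratedDeriv_zero]
      push_cast
      ring
    · refine integral_congr_ae (Filter.Eventually.of_forall fun ζ => ?_)
      simp only [h1, derivSymbol]
      ring
  have hmain := hw.2 ψ hψ hψc
  rw [Complex.ofReal_mul, hφ1, hφ2, hφ3] at hmain
  have hi1 := hm1.schwartzIntegrable χ
  have hi2 := hm2.schwartzIntegrable χ
  have hi3 := hdU.schwartzIntegrable χ
  have hi23 : Integrable fun ζ =>
      χ ζ * (((4 * Real.pi ^ 2 * ‖ζ‖ ^ 2 : ℝ) : ℂ) * (symbolHilbert ζ * Φ ζ)) +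
        χ ζ * derivSymbol (planeBasis 0) U ζ := hi2.add hi3
  calc _ = ∫ ζ, (χ ζ * (-(c : ℂ) * derivSymbol (planeBasis 0) Φ ζ) +
        (χ ζ * (((4 * Real.pi ^ 2 * ‖ζ‖ ^ 2 : ℝ) : ℂ) * (symbolHilbert ζ * Φ ζ)) +
          χ ζ * derivSymbol (planeBasis 0) U ζ)) := by
        refine integral_congr_ae (Filter.Eventually.of_forall fun ζ => ?_)
        simp only [fourierResidual]
        ring
    _ = 0 := by
        rw [integral_add hi1 hi23, integral_add hi2 hi3]
        simp only [mul_left_comm _ (-(c : ℂ)), integral_const_mul]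
        linear_combination hmain

/-- On the line `ξ = 0` every term of the transformed equation vanishes and nothing is learnt about
`Φ`; the line is a null set. -/
theorem ae_apply_zero_ne_zero : ∀ᵐ ζ : Plane, ζ 0 ≠ 0 := by
  let S : Submodule ℝ Plane :=
    LinearMap.ker (EuclideanSpace.proj (0 : Fin 2) : Plane →L[ℝ] ℝ).toLinearMap
  have hS : S ≠ ⊤ := fun h => by
    have : planeBasis 0 ∈ S := h ▸ Submodule.mem_top
    simp [S, planeBasis] at this
  have h := Measure.addHaar_submodule (volume : Measure Plane) S hS
  rw [ae_iff]
  convert h using 2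
  ext ζ
  simp [S]

/-- Divided by `2πi`, the equation gives `(c|ξ| + 2π|ζ|²)|Φ| = |ξ||U|`. The left factor is at least
`w²` and `|ξ| ≤ w`, so one power of `w` cancels. -/
theorem planeWeight_mul_enorm_le_of_fourierResidual {c : ℝ} (hc : 0 ≤ c) {Φ U : Plane → ℂ}
    {ζ : Plane} (hζ : ζ 0 ≠ 0) (h : fourierResidual c Φ U ζ = 0) :
    planeWeight ζ * ‖Φ ζ‖ₑ ≤ ‖U ζ‖ₑ := by
  have hpi := Real.pi_pos
  have hpi2 := Real.two_le_pi
  have hs : |Real.sign (ζ 0)| = 1 := by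
    rcases lt_or_gt_of_ne hζ with h0 | h0
    · simp [Real.sign_of_neg h0]
    · simp [Real.sign_of_pos h0]
  have hsx : ζ 0 = Real.sign (ζ 0) * |ζ 0| := by
    rcases lt_or_gt_of_ne hζ with h0 | h0
    · simp [Real.sign_of_neg h0, abs_of_neg h0]
    · simp [Real.sign_of_pos h0, abs_of_pos h0]
  have h1 : ((Real.sign (ζ 0) * (c * |ζ 0| + 2 * Real.pi * ‖ζ‖ ^ 2) : ℝ) : ℂ) * Φ ζ =
      ((ζ 0 : ℝ) : ℂ) * U ζ := by
    have hI : (2 * Real.pi * Complex.I : ℂ) ≠ 0 := by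
      simp [hpi.ne']
    refine mul_left_cancel₀ hI ?_
    have hsx' : ((ζ 0 : ℝ) : ℂ) = ((Real.sign (ζ 0) : ℝ) : ℂ) * ((|ζ 0| : ℝ) : ℂ) := by
      exact_mod_cast hsx
    simp only [fourierResidual, derivSymbol, inner_planeBasis, symbolHilbert] at h
    push_cast at h ⊢
    linear_combination -h - 2 * Real.pi * Complex.I * c * Φ ζ * hsx'
  have h2 : (c * |ζ 0| + 2 * Real.pi * ‖ζ‖ ^ 2) * ‖Φ ζ‖ = |ζ 0| * ‖U ζ‖ := by
    have := congrArg norm h1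
    rwa [norm_mul, norm_mul, Complex.norm_real, Complex.norm_real, Real.norm_eq_abs,
      Real.norm_eq_abs, abs_mul, hs, one_mul, abs_of_nonneg (by positivity)] at this
  set w : ℝ := |ζ 0| + |ζ 1| with hw
  have hw0 : 0 < w := by positivity
  -- `(a + b)² ≤ 2(a² + b²)`, and `π ≥ 1`.
  have hsq : w ^ 2 ≤ 2 * Real.pi * ‖ζ‖ ^ 2 := by
    have h3 : ‖ζ‖ ^ 2 = |ζ 0| ^ 2 + |ζ 1| ^ 2 := by
      rw [EuclideanSpace.real_norm_sq_eq, Fin.sum_univ_two, sq_abs, sq_abs]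
    rw [h3, hw]
    nlinarith [sq_nonneg (|ζ 0| - |ζ 1|), sq_nonneg |ζ 0|, sq_nonneg |ζ 1|]
  have h3 : w * ‖Φ ζ‖ ≤ ‖U ζ‖ := by
    refine le_of_mul_le_mul_left ?_ hw0
    calc w * (w * ‖Φ ζ‖) = w ^ 2 * ‖Φ ζ‖ := by ring
      _ ≤ (c * |ζ 0| + 2 * Real.pi * ‖ζ‖ ^ 2) * ‖Φ ζ‖ := by
          gcongr
          exact hsq.trans (le_add_of_nonneg_left (by positivity))
      _ = |ζ 0| * ‖U ζ‖ := h2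
      _ ≤ w * ‖U ζ‖ := by
          gcongr
          exact le_add_of_nonneg_right (abs_nonneg _)
  have h4 : planeWeight ζ = ENNReal.ofReal w := by
    rw [planeWeight, hw, ENNReal.ofReal_add (abs_nonneg _) (abs_nonneg _), ← Real.norm_eq_abs,
      ← Real.norm_eq_abs, ofReal_norm, ofReal_norm]
  rw [h4, ← ofReal_norm, ← ofReal_norm, ← ENNReal.ofReal_mul hw0.le]
  exact ENNReal.ofReal_le_ofReal h3

theorem enorm_le_planeWeight (ζ : Plane) : ‖ζ‖ₑ ≤ planeWeight ζ := by
  rw [planeWeight, ← ofReal_norm, ← ofReal_norm, ← ofReal_norm,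
    ← ENNReal.ofReal_add (norm_nonneg _) (norm_nonneg _)]
  refine ENNReal.ofReal_le_ofReal (abs_le_of_sq_le_sq' ?_ (by positivity)).2
  rw [EuclideanSpace.real_norm_sq_eq, Fin.sum_univ_two, Real.norm_eq_abs, Real.norm_eq_abs,
    ← sq_abs (ζ 0), ← sq_abs (ζ 1)]
  nlinarith [mul_nonneg (abs_nonneg (ζ 0)) (abs_nonneg (ζ 1))]

/-- The hypothesis starts at the first moment, so `∫ ‖Φ‖` enters the constant for `n = 0`; `A + 1`
makes the base positive and absorbs the index shift. -/
theorem integral_norm_pow_mul_le {Φ : Plane → ℂ} (hΦ : HasMoments Φ) {C A : ℝ≥0∞} (hC : C ≠ ⊤)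
    (hA : A ≠ ⊤)
    (h : ∀ n : ℕ, ∫⁻ ζ, planeWeight ζ ^ (n + 1) * ‖Φ ζ‖ₑ ≤ C * A ^ n * n.factorial) (n : ℕ) :
    ∫ ζ, ‖ζ‖ ^ n * ‖Φ ζ‖ ≤
      ((∫ ζ, ‖Φ ζ‖) + C.toReal) * (A.toReal + 1) ^ n * n.factorial := by
  have hI : 0 ≤ ∫ ζ, ‖Φ ζ‖ := integral_nonneg fun _ => norm_nonneg _
  rcases n with _ | n
  · simp
  · have h1 : ∫ ζ, ‖ζ‖ ^ (n + 1) * ‖Φ ζ‖ ≤ C.toReal * A.toReal ^ n * n.factorial := by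
      rw [integral_eq_lintegral_of_nonneg_ae
        (Filter.Eventually.of_forall fun ζ => by positivity) (hΦ.integrable_pow _).1]
      have h2 : C.toReal * A.toReal ^ n * n.factorial =
          (C * A ^ n * n.factorial).toReal := by simp
      rw [h2]
      refine ENNReal.toReal_mono (ENNReal.mul_ne_top (ENNReal.mul_ne_top hC
        (ENNReal.pow_ne_top hA)) (ENNReal.natCast_ne_top _)) (le_trans ?_ (h n))
      refine lintegral_mono fun ζ => ?_
      rw [ENNReal.ofReal_mul (by positivity), ENNReal.ofReal_pow (norm_nonneg _), ofReal_norm,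
        ofReal_norm]
      gcongr
      exact enorm_le_planeWeight ζ
    refine h1.trans ?_
    have hA0 : 0 ≤ A.toReal := ENNReal.toReal_nonneg
    have hC0 : 0 ≤ C.toReal := ENNReal.toReal_nonneg
    have hfac : (n.factorial : ℝ) ≤ (n + 1).factorial := by
      exact_mod_cast Nat.factorial_le (Nat.le_succ n)
    have hpow : A.toReal ^ n ≤ (A.toReal + 1) ^ (n + 1) :=
      (pow_le_pow_left₀ hA0 (by linarith) n).trans
        (pow_le_pow_right₀ (by linarith) (Nat.le_succ n))
    gcongr
    linarith

end SolitaryWave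

theorem theorem3p4 (f : ℝ → ℝ) (hf : ContDiff ℝ ∞ f)
    (hbound : ∀ R : ℝ, 0 < R → ∃ M : ℝ, 0 < M ∧ ∀ x : ℝ, |x| < R → ∀ n : ℕ,
      |iteratedDeriv n f x| ≤ M ^ (n + 1) * (Nat.factorial n : ℝ))
    (c : ℝ) (hc : 0 < c) (φ : L2R) (hZ : MemZ φ) (hH : MemHInfty φ)
    (hφ : IsSolitaryWave f c φ) :
    ∃ g : Plane → ℝ, AnalyticOnNhd ℝ g Set.univ ∧ (φ : Plane → ℝ) =ᵐ[volume] g := by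
  obtain ⟨g, hg, hae⟩ := exists_isTameProfile hH
  set Φ : Plane → ℂ := ⇑(𝓕 (toL2C φ) : L2C) with hΦdef
  refine ⟨g, ?_, hae⟩
  -- `∫ ‖Φ‖` bounds `|g|`; adding `1` makes the inequality strict and the radius positive.
  have hR0 : 0 < (∫ ζ, ‖Φ ζ‖) + 1 := by
    have : 0 ≤ ∫ ζ, ‖Φ ζ‖ := integral_nonneg fun _ => norm_nonneg _
    linarith
  obtain ⟨M, hM0, hM⟩ := hbound _ hR0
  have D : IsTameComposition f g Φ ((∫ ζ, ‖Φ ζ‖) + 1) (max M 1) :=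
    ⟨hf, hg, fun x => (hg.abs_le x).trans_lt (lt_add_one _), le_max_right _ _,
      fun t ht n => (hM t ht n).trans (by gcongr; exact le_max_left _ _)⟩
  obtain ⟨U, C, N, hC, hN, hU⟩ := D.exists_transforms
  have hres := fourierResidual_ae_eq_zero D hae (hU 0).2.2.1 (hU 0).2.2.2.1 hφ
  have hle : ∀ᵐ ζ, planeWeight ζ * ‖Φ ζ‖ₑ ≤ ‖U 0 ζ‖ₑ := by
    filter_upwards [hres, ae_apply_zero_ne_zero] with ζ h1 h2
    exact planeWeight_mul_enorm_le_of_fourierResidual hc.le h2 h1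
  have hmom := D.lintegral_planeWeight_pow_le hC hN (Lp.stronglyMeasurable _).measurable
    (fun k => (hU k).1) (fun k => (hU k).2.1) (fun k => (hU k).2.2.2.1)
    (fun k => (hU k).2.2.2.2) hle
  have hA : 2 * N * C ≠ ⊤ := ENNReal.mul_ne_top (ENNReal.mul_ne_top (by simp) hN) hC
  have hfin := integral_norm_pow_mul_le hg.toHasMoments hC hA hmom
  intro x _
  rw [hg.eq_re]
  exact (Complex.reCLM.analyticAt _).comp
    (hg.toHasMoments.analyticAt_fourierInv (by positivity) hfin x)
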